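/- All $C^*$-algebras are complex, and $\otimes$ denotes the minimal (spatial) tensor product of unital $C^*$-algebras, i.e. the completion of the algebraic tensor product $A\odot B$ in the norm $\|x\|=\sup\|(\pi\otimes\rho)(x)\|$, where $\pi,\rho$ range over the unital $*$-representations of $A$ and $B$ on Hilbert spaces $H$ and $K$, and $\pi\otimes\rho$ acts on the Hilbert space tensor product of $H$ and $K$. A separable unital $C^*$-algebra $\mathcal D$ is called strongly self-absorbing if $\mathcal D\not\cong\mathbb C$ and there are a $*$-isomorphism $\varphi:\mathcal D\to\mathcal D\otimes\mathcal D$ and a sequence $(u_n)_{n\in\mathbb N}$ of unitaries in $\mathcal D\otimes\mathcal D$ such that $\|u_n\varphi(d)u_n^*-d\otimes \mathbf 1_{\mathcal D}\|\to 0$ as $n\to\infty$ for every $d\in\mathcal D$. **Proposition.** Let $\mathcal D$ and $A$ be separable, unital, strongly self-absorbing $C^*$-algebras. Suppose that for every finite subset $\mathcal F\subset\mathcal D$ and every $\varepsilon>0$ there is a unital completely positive linear map $\varphi:\mathcal D\to A$ such that $\|\varphi(cd)-\varphi(c)\varphi(d)\|<\varepsilon$ for all $c,d\in\mathcal F$.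 Then $A$ and $A\otimes\mathcal D$ are isomorphic as $C^*$-algebras. -/

import Mathlib

open scoped TensorProduct Topology
open UniformSpace Filter

universe u v

noncomputable section

/-! ### Tensor products of Hilbert space operators and of representations -/

section Representations

variable {H : Type u} [NormedAddCommGroup H] [InnerProductSpace ℂ H]
  {K : Type v} [NormedAddCommGroup K] [InnerProductSpace ℂ K]

/-- The Hilbert space tensor product: the completion of the algebraic tensor product with respect
to the inner product `⟪ξ ⊗ η, ξ' ⊗ η'⟫ = ⟪ξ, ξ'⟫ * ⟪η, η'⟫`. -/
def HilbertTensor (H : Type u) [NormedAddCommGroup H] [InnerProductSpace ℂ H]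
    (K : Type v) [NormedAddCommGroup K] [InnerProductSpace ℂ K] : Type (max u v) :=
  Completion (H ⊗[ℂ] K)

instance : NormedAddCommGroup (HilbertTensor H K) :=
  inferInstanceAs (NormedAddCommGroup (Completion (H ⊗[ℂ] K)))
instance : InnerProductSpace ℂ (HilbertTensor H K) :=
  inferInstanceAs (InnerProductSpace ℂ (Completion (H ⊗[ℂ] K)))
instance : CompleteSpace (HilbertTensor H K) :=
  inferInstanceAs (CompleteSpace (Completion (H ⊗[ℂ] K)))

/-- The canonical isometry of the algebraic tensor product into the Hilbert space tensor product. -/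
def HilbertTensor.of : H ⊗[ℂ] K →ₗᵢ[ℂ] HilbertTensor H K :=
  (Completion.toComplₗᵢ : H ⊗[ℂ] K →ₗᵢ[ℂ] Completion (H ⊗[ℂ] K))

theorem HilbertTensor.induction_on {p : HilbertTensor H K → Prop} (x : HilbertTensor H K)
    (hp : IsClosed {x | p x}) (ih : ∀ x : H ⊗[ℂ] K, p (HilbertTensor.of x)) : p x :=
  Completion.induction_on (p := p) x hp ih

/-- The bounded operator `S ⊗ T` on the Hilbert space tensor product,
`(S ⊗ T) (ξ ⊗ η) = S ξ ⊗ T η`. -/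
def opTensor (S : H →L[ℂ] H) (T : K →L[ℂ] K) : HilbertTensor H K →L[ℂ] HilbertTensor H K :=
  ((TensorProduct.mapL S T).completion : Completion (H ⊗[ℂ] K) →L[ℂ] Completion (H ⊗[ℂ] K))

theorem opTensor_of (S : H →L[ℂ] H) (T : K →L[ℂ] K) (x : H ⊗[ℂ] K) :
    opTensor S T (HilbertTensor.of x) = HilbertTensor.of (TensorProduct.mapL S T x) :=
  ContinuousLinearMap.completion_apply_coe _ _

theorem hilbertTensor_ext {S T : HilbertTensor H K →L[ℂ] HilbertTensor H K}
    (h : ∀ x : H ⊗[ℂ] K, S (HilbertTensor.of x) = T (HilbertTensor.of x)) : S = T := by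
  ext x
  induction x using HilbertTensor.induction_on with
  | hp => exact isClosed_eq S.continuous T.continuous
  | ih x => exact h x

theorem opTensor_add_left (S S' : H →L[ℂ] H) (T : K →L[ℂ] K) :
    opTensor (S + S') T = opTensor S T + opTensor S' T :=
  hilbertTensor_ext fun x => by
    simp only [_root_.add_apply, opTensor_of, TensorProduct.mapL_add_left,
      map_add]

theorem opTensor_add_right (S : H →L[ℂ] H) (T T' : K →L[ℂ] K) :
    opTensor S (T + T') = opTensor S T + opTensor S T' :=
  hilbertTensor_ext fun x => by
    simp only [_root_.add_apply, opTensor_of, TensorProduct.mapL_add_right,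
      map_add]

theorem opTensor_smul_left (c : ℂ) (S : H →L[ℂ] H) (T : K →L[ℂ] K) :
    opTensor (c • S) T = c • opTensor S T :=
  hilbertTensor_ext fun x => by
    simp only [_root_.smul_apply, opTensor_of, TensorProduct.mapL_smul_left,
      map_smul]

theorem opTensor_smul_right (c : ℂ) (S : H →L[ℂ] H) (T : K →L[ℂ] K) :
    opTensor S (c • T) = c • opTensor S T :=
  hilbertTensor_ext fun x => by
    simp only [_root_.smul_apply, opTensor_of, TensorProduct.mapL_smul_right,
      map_smul]

theorem opTensor_mul (S S' : H →L[ℂ] H) (T T' : K →L[ℂ] K) :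
    opTensor (S * S') (T * T') = opTensor S T * opTensor S' T' :=
  hilbertTensor_ext fun x => by
    simp only [mul_apply_eq_comp, opTensor_of, TensorProduct.mapL_mul]

theorem opTensor_one : opTensor (1 : H →L[ℂ] H) (1 : K →L[ℂ] K) = 1 :=
  hilbertTensor_ext fun x => by
    rw [opTensor_of]
    exact congrArg _ (congrArg (fun f => f x) TensorProduct.mapL_id_id)

theorem opTensor_star [CompleteSpace H] [CompleteSpace K] (S : H →L[ℂ] H) (T : K →L[ℂ] K) :
    opTensor (star S) (star T) = star (opTensor S T) := by
  refine (ContinuousLinearMap.eq_adjoint_iff _ _).mpr fun x y => ?_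
  induction x using HilbertTensor.induction_on with
  | hp => apply isClosed_eq <;> fun_prop
  | ih x =>
    induction y using HilbertTensor.induction_on with
    | hp => apply isClosed_eq <;> fun_prop
    | ih y =>
    rw [opTensor_of, opTensor_of, LinearIsometry.inner_map_map, LinearIsometry.inner_map_map]
    induction x using TensorProduct.induction_on with
    | zero => simp
    | add x x' hx hx' => simp only [map_add, inner_add_left, hx, hx']
    | tmul a b =>
      induction y using TensorProduct.induction_on with
      | zero => simp
      | add y y' hy hy' => simp only [map_add, inner_add_right, hy, hy']
      | tmul c d =>
        rw [TensorProduct.mapL_tmul, TensorProduct.mapL_tmul, TensorProduct.inner_tmul,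
          TensorProduct.inner_tmul, ContinuousLinearMap.star_eq_adjoint,
          ContinuousLinearMap.star_eq_adjoint, ContinuousLinearMap.adjoint_inner_left,
          ContinuousLinearMap.adjoint_inner_left]

theorem norm_opTensor_le (S : H →L[ℂ] H) (T : K →L[ℂ] K) : ‖opTensor S T‖ ≤ ‖S‖ * ‖T‖ := by
  refine ContinuousLinearMap.opNorm_le_bound _ (by positivity) fun x => ?_
  induction x using HilbertTensor.induction_on with
  | hp => apply isClosed_le <;> fun_prop
  | ih x =>
    rw [opTensor_of, LinearIsometry.norm_map, LinearIsometry.norm_map]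
    exact (ContinuousLinearMap.le_opNorm _ _).trans
      (mul_le_mul_of_nonneg_right (TensorProduct.norm_mapL_le S T) (norm_nonneg _))

end Representations

/-! ### The minimal tensor product -/

/-- The algebraic tensor product of two unital C⋆-algebras, as a type of its own, which will carry
the minimal C⋆-norm. -/
def AlgTensor (A : Type u) (B : Type v) [CStarAlgebra A] [CStarAlgebra B] : Type (max u v) :=
  A ⊗[ℂ] B

section MinimalNorm

variable {A : Type u} {B : Type v} [CStarAlgebra A] [CStarAlgebra B]

instance : Ring (AlgTensor A B) := inferInstanceAs (Ring (A ⊗[ℂ] B))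
instance : Algebra ℂ (AlgTensor A B) := inferInstanceAs (Algebra ℂ (A ⊗[ℂ] B))
instance : StarRing (AlgTensor A B) := inferInstanceAs (StarRing (A ⊗[ℂ] B))
instance : StarModule ℂ (AlgTensor A B) := inferInstanceAs (StarModule ℂ (A ⊗[ℂ] B))

/-- The elementary tensor `a ⊗ b`. -/
def AlgTensor.tmul (a : A) (b : B) : AlgTensor A B := a ⊗ₜ[ℂ] b

theorem AlgTensor.tmul_mul_tmul (a a' : A) (b b' : B) :
    AlgTensor.tmul a b * AlgTensor.tmul a' b' = AlgTensor.tmul (a * a') (b * b') :=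
  Algebra.TensorProduct.tmul_mul_tmul a a' b b'

theorem AlgTensor.star_tmul (a : A) (b : B) :
    star (AlgTensor.tmul a b) = AlgTensor.tmul (star a) (star b) :=
  TensorProduct.star_tmul a b

theorem AlgTensor.induction_on {p : AlgTensor A B → Prop} (x : AlgTensor A B) (zero : p 0)
    (tmul : ∀ a b, p (AlgTensor.tmul a b)) (add : ∀ x y, p x → p y → p (x + y)) : p x :=
  TensorProduct.induction_on (motive := p) x zero tmul add

variable (A B) in
/-- A pair of unital ⋆-representations, `π` of `A` on a Hilbert space `H` and `ρ` of `B` on a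
Hilbert space `K`. -/
structure RepPair where
  H : Type u
  K : Type v
  [normedH : NormedAddCommGroup H]
  [innerH : InnerProductSpace ℂ H]
  [completeH : CompleteSpace H]
  [normedK : NormedAddCommGroup K]
  [innerK : InnerProductSpace ℂ K]
  [completeK : CompleteSpace K]
  π : A →⋆ₐ[ℂ] (H →L[ℂ] H)
  ρ : B →⋆ₐ[ℂ] (K →L[ℂ] K)

attribute [instance] RepPair.normedH RepPair.innerH RepPair.completeH RepPair.normedK
  RepPair.innerK RepPair.completeK

/-- The operators on the Hilbert space tensor product of the spaces of a pair of
representations. -/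
abbrev RepPair.Op (p : RepPair A B) := HilbertTensor p.H p.K →L[ℂ] HilbertTensor p.H p.K

/-- The tensor product representation `π ⊗ ρ` as a linear map. -/
def RepPair.repLin (p : RepPair A B) : AlgTensor A B →ₗ[ℂ] p.Op :=
  (TensorProduct.lift <| LinearMap.mk₂ ℂ (fun a b => opTensor (p.π a) (p.ρ b))
    (fun a a' b => by rw [map_add, opTensor_add_left])
    (fun c a b => by rw [map_smul, opTensor_smul_left])
    (fun a b b' => by rw [map_add, opTensor_add_right])
    (fun c a b => by rw [map_smul, opTensor_smul_right]) : A ⊗[ℂ] B →ₗ[ℂ] p.Op)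

theorem RepPair.repLin_tmul (p : RepPair A B) (a : A) (b : B) :
    p.repLin (AlgTensor.tmul a b) = opTensor (p.π a) (p.ρ b) := rfl

theorem RepPair.repLin_one (p : RepPair A B) : p.repLin 1 = 1 := by
  change opTensor (p.π 1) (p.ρ 1) = 1
  rw [map_one, map_one, opTensor_one]

/-- The tensor product representation `π ⊗ ρ` of the algebraic tensor product, determined by
`(π ⊗ ρ) (a ⊗ b) = π a ⊗ ρ b`. -/
def RepPair.rep (p : RepPair A B) : AlgTensor A B →⋆ₐ[ℂ] p.Op where
  toFun x := p.repLin x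
  map_one' := p.repLin_one
  map_zero' := map_zero p.repLin
  map_add' x y := map_add p.repLin x y
  map_mul' x y := by
    induction x using AlgTensor.induction_on with
    | zero => rw [zero_mul, map_zero, zero_mul]
    | add x x' hx hx' => rw [add_mul, map_add, map_add, hx, hx', add_mul]
    | tmul a b =>
      induction y using AlgTensor.induction_on with
      | zero => rw [mul_zero, map_zero, mul_zero]
      | add y y' hy hy' => rw [mul_add, map_add, map_add, hy, hy', mul_add]
      | tmul c d =>
        rw [AlgTensor.tmul_mul_tmul, repLin_tmul, repLin_tmul, repLin_tmul, map_mul, map_mul,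
          opTensor_mul]
  commutes' c := by
    rw [Algebra.algebraMap_eq_smul_one, Algebra.algebraMap_eq_smul_one, map_smul, repLin_one]
  map_star' x := by
    induction x using AlgTensor.induction_on with
    | zero => rw [star_zero, map_zero, star_zero]
    | add x x' hx hx' => rw [star_add, map_add, map_add, hx, hx', star_add]
    | tmul a b =>
      rw [AlgTensor.star_tmul, repLin_tmul, repLin_tmul, map_star, map_star, opTensor_star]

theorem RepPair.rep_tmul (p : RepPair A B) (a : A) (b : B) :
    p.rep (AlgTensor.tmul a b) = opTensor (p.π a) (p.ρ b) := rfl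

/-- The minimal (spatial) norm on the algebraic tensor product: the supremum of `‖(π ⊗ ρ) x‖` over
all pairs of unital ⋆-representations. -/
instance : Norm (AlgTensor A B) where
  norm x := ⨆ p : RepPair A B, ‖p.rep x‖

theorem AlgTensor.norm_def (x : AlgTensor A B) : ‖x‖ = ⨆ p : RepPair A B, ‖p.rep x‖ := rfl

theorem AlgTensor.bddAbove (x : AlgTensor A B) :
    BddAbove (Set.range fun p : RepPair A B => ‖p.rep x‖) := by
  suffices h : ∃ C, ∀ p : RepPair A B, ‖p.rep x‖ ≤ C by
    obtain ⟨C, hC⟩ := h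
    exact ⟨C, by rintro _ ⟨p, rfl⟩; exact hC p⟩
  induction x using AlgTensor.induction_on with
  | zero => exact ⟨0, fun p => by simp⟩
  | add x y hx hy =>
    obtain ⟨C, hC⟩ := hx
    obtain ⟨C', hC'⟩ := hy
    exact ⟨C + C', fun p => by
      rw [map_add]; exact (norm_add_le _ _).trans (add_le_add (hC p) (hC' p))⟩
  | tmul a b =>
    refine ⟨‖a‖ * ‖b‖, fun p => ?_⟩
    rw [p.rep_tmul]
    exact (norm_opTensor_le _ _).trans (mul_le_mul (NonUnitalStarAlgHom.norm_apply_le p.π a)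
      (NonUnitalStarAlgHom.norm_apply_le p.ρ b) (norm_nonneg _) (norm_nonneg _))

theorem AlgTensor.norm_rep_le (p : RepPair A B) (x : AlgTensor A B) : ‖p.rep x‖ ≤ ‖x‖ :=
  le_ciSup (AlgTensor.bddAbove x) p

theorem AlgTensor.norm_nonneg' (x : AlgTensor A B) : 0 ≤ ‖x‖ :=
  Real.iSup_nonneg fun _ => norm_nonneg _

theorem AlgTensor.norm_le {x : AlgTensor A B} {C : ℝ} (hC : 0 ≤ C)
    (h : ∀ p : RepPair A B, ‖p.rep x‖ ≤ C) : ‖x‖ ≤ C :=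
  Real.iSup_le h hC

theorem AlgTensor.norm_smul_le' (c : ℂ) (x : AlgTensor A B) : ‖c • x‖ ≤ ‖c‖ * ‖x‖ :=
  AlgTensor.norm_le (mul_nonneg (norm_nonneg c) (AlgTensor.norm_nonneg' x)) fun p => by
    rw [map_smul]
    exact (norm_smul_le _ _).trans
      (mul_le_mul_of_nonneg_left (AlgTensor.norm_rep_le p x) (norm_nonneg c))

instance : SeminormedRing (AlgTensor A B) :=
  { (AddGroupSeminorm.toSeminormedAddCommGroup
      { toFun := fun x : AlgTensor A B => ‖x‖
        map_zero' := le_antisymm (AlgTensor.norm_le le_rfl fun p => by simp)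
          (AlgTensor.norm_nonneg' _)
        add_le' := fun x y => AlgTensor.norm_le
          (add_nonneg (AlgTensor.norm_nonneg' _) (AlgTensor.norm_nonneg' _)) fun p => by
            rw [map_add]
            exact (norm_add_le _ _).trans
              (add_le_add (AlgTensor.norm_rep_le p x) (AlgTensor.norm_rep_le p y))
        neg' := fun x => by simp only [AlgTensor.norm_def, map_neg, norm_neg] } :
      SeminormedAddCommGroup (AlgTensor A B)),
    (inferInstance : Ring (AlgTensor A B)) with
    norm_mul_le := fun x y => AlgTensor.norm_le
      (mul_nonneg (AlgTensor.norm_nonneg' _) (AlgTensor.norm_nonneg' _)) fun p => by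
        rw [map_mul]
        exact (norm_mul_le _ _).trans (mul_le_mul (AlgTensor.norm_rep_le p x)
          (AlgTensor.norm_rep_le p y) (norm_nonneg _) (AlgTensor.norm_nonneg' _)) }

instance : NormedAlgebra ℂ (AlgTensor A B) where
  norm_smul_le := AlgTensor.norm_smul_le'

instance : NormedStarGroup (AlgTensor A B) where
  norm_star_le x := by simp only [AlgTensor.norm_def, map_star, norm_star, le_refl]

theorem AlgTensor.norm_mul_self_le (x : AlgTensor A B) : ‖x‖ * ‖x‖ ≤ ‖star x * x‖ := by
  have h : ‖x‖ ≤ √‖star x * x‖ := AlgTensor.norm_le (Real.sqrt_nonneg _) fun p => by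
    refine Real.le_sqrt_of_sq_le ?_
    rw [sq, ← CStarRing.norm_star_mul_self, ← map_star, ← map_mul]
    exact AlgTensor.norm_rep_le p _
  calc ‖x‖ * ‖x‖ ≤ √‖star x * x‖ * √‖star x * x‖ :=
        mul_le_mul h h (AlgTensor.norm_nonneg' _) (Real.sqrt_nonneg _)
    _ = ‖star x * x‖ := Real.mul_self_sqrt (AlgTensor.norm_nonneg' _)

end MinimalNorm

/-- The minimal (spatial) tensor product `A ⊗ B` of two unital C⋆-algebras: the completion of the
algebraic tensor product in the minimal C⋆-norm. -/
def MinTensor (A : Type u) (B : Type v) [CStarAlgebra A] [CStarAlgebra B] : Type (max u v) :=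
  Completion (AlgTensor A B)

namespace MinTensor

variable {A : Type u} {B : Type v} [CStarAlgebra A] [CStarAlgebra B]

instance : NormedRing (MinTensor A B) := inferInstanceAs (NormedRing (Completion (AlgTensor A B)))
instance : CompleteSpace (MinTensor A B) :=
  inferInstanceAs (CompleteSpace (Completion (AlgTensor A B)))
instance : Algebra ℂ (MinTensor A B) := inferInstanceAs (Algebra ℂ (Completion (AlgTensor A B)))

/-- The canonical map from the algebraic tensor product. -/
def ofAlg (x : AlgTensor A B) : MinTensor A B := (x : Completion (AlgTensor A B))

theorem norm_ofAlg (x : AlgTensor A B) : ‖ofAlg x‖ = ‖x‖ := Completion.norm_coe x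
theorem ofAlg_one : ofAlg (1 : AlgTensor A B) = 1 := rfl
theorem ofAlg_zero : ofAlg (0 : AlgTensor A B) = 0 := rfl
theorem ofAlg_add (x y : AlgTensor A B) : ofAlg (x + y) = ofAlg x + ofAlg y :=
  Completion.coe_add x y
theorem ofAlg_mul (x y : AlgTensor A B) : ofAlg (x * y) = ofAlg x * ofAlg y :=
  Completion.coe_mul x y
theorem ofAlg_smul (c : ℂ) (x : AlgTensor A B) : ofAlg (c • x) = c • ofAlg x :=
  Completion.coe_smul c x
theorem continuous_ofAlg : Continuous (ofAlg : AlgTensor A B → MinTensor A B) :=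
  Completion.continuous_coe _

theorem denseRange_ofAlg : DenseRange (ofAlg : AlgTensor A B → MinTensor A B) :=
  Completion.denseRange_coe

theorem induction_on {p : MinTensor A B → Prop} (x : MinTensor A B) (hp : IsClosed {x | p x})
    (ih : ∀ x : AlgTensor A B, p (ofAlg x)) : p x :=
  Completion.induction_on (p := p) x hp ih

instance : NormedAlgebra ℂ (MinTensor A B) where
  norm_smul_le c x := by
    have : NormedSpace ℂ (Completion (AlgTensor A B)) := inferInstance
    exact norm_smul_le (β := Completion (AlgTensor A B)) c x

/-- The involution of the minimal tensor product: the continuous extension of the involution of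
the algebraic tensor product. -/
instance : Star (MinTensor A B) where
  star x := Completion.map (star : AlgTensor A B → AlgTensor A B) x

theorem star_ofAlg (x : AlgTensor A B) : star (ofAlg x) = ofAlg (star x) :=
  Completion.map_coe (starNormedAddGroupHom (E := AlgTensor A B)).uniformContinuous x

theorem continuous_star' : Continuous (star : MinTensor A B → MinTensor A B) :=
  Completion.continuous_map

instance : StarRing (MinTensor A B) where
  star_involutive x := by
    induction x using induction_on with
    | hp => exact isClosed_eq (continuous_star'.comp continuous_star') continuous_id
    | ih x => rw [star_ofAlg, star_ofAlg, star_star]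
  star_mul x y := by
    induction x using induction_on with
    | hp =>
      exact isClosed_eq (continuous_star'.comp (continuous_id.mul continuous_const))
        (continuous_const.mul continuous_star')
    | ih x =>
      induction y using induction_on with
      | hp =>
        exact isClosed_eq (continuous_star'.comp (continuous_const.mul continuous_id))
          (continuous_star'.mul continuous_const)
      | ih y => rw [← ofAlg_mul, star_ofAlg, star_ofAlg, star_ofAlg, star_mul, ofAlg_mul]
  star_add x y := by
    induction x using induction_on with
    | hp =>
      exact isClosed_eq (continuous_star'.comp (continuous_id.add continuous_const))
        (continuous_star'.add continuous_const)
    | ih x =>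
      induction y using induction_on with
      | hp =>
        exact isClosed_eq (continuous_star'.comp (continuous_const.add continuous_id))
          (continuous_const.add continuous_star')
      | ih y => rw [← ofAlg_add, star_ofAlg, star_ofAlg, star_ofAlg, star_add, ofAlg_add]

instance : StarModule ℂ (MinTensor A B) where
  star_smul c x := by
    induction x using induction_on with
    | hp =>
      exact isClosed_eq (continuous_star'.comp (continuous_const_smul c))
        (continuous_star'.const_smul (star c))
    | ih x => rw [← ofAlg_smul, star_ofAlg, star_ofAlg, star_smul, ofAlg_smul]

instance : CStarRing (MinTensor A B) where
  norm_mul_self_le x := by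
    induction x using induction_on with
    | hp =>
      exact isClosed_le (continuous_norm.mul continuous_norm)
        (continuous_norm.comp (continuous_star'.mul continuous_id))
    | ih x =>
      rw [star_ofAlg, ← ofAlg_mul, norm_ofAlg, norm_ofAlg]
      exact AlgTensor.norm_mul_self_le x

instance : CStarAlgebra (MinTensor A B) where

/-- The elementary tensor `a ⊗ b` in the minimal tensor product. -/
def tmul (a : A) (b : B) : MinTensor A B := ofAlg (AlgTensor.tmul a b)

/-- The first factor embedding `a ↦ a ⊗ 1`, that is `id_A ⊗ 1_B`. -/
def inl (A : Type u) (B : Type v) [CStarAlgebra A] [CStarAlgebra B] : A →⋆ₐ[ℂ] MinTensor A B where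
  toFun a := tmul a 1
  map_one' := rfl
  map_zero' := congrArg ofAlg (TensorProduct.zero_tmul A (1 : B))
  map_add' a a' := (congrArg ofAlg (TensorProduct.add_tmul a a' (1 : B))).trans (ofAlg_add _ _)
  map_mul' a a' := by
    rw [tmul, tmul, tmul, ← ofAlg_mul, AlgTensor.tmul_mul_tmul, mul_one]
  commutes' c := rfl
  map_star' a := by rw [tmul, tmul, star_ofAlg, AlgTensor.star_tmul, star_one]

end MinTensor

/-! ### Strongly self-absorbing C⋆-algebras -/

/-- Approximate unitary equivalence of two ⋆-homomorphisms into a unital C⋆-algebra. -/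
def ApproxUnitarilyEquiv {A : Type u} {B : Type v} [NonUnitalCStarAlgebra A] [CStarAlgebra B]
    (σ γ : A →⋆ₙₐ[ℂ] B) : Prop :=
  ∃ w : ℕ → unitary B, ∀ a : A,
    Tendsto (fun n => ‖(w n : B) * σ a * star (w n : B) - γ a‖) atTop (𝓝 0)

/-- A unital C⋆-algebra `D` is strongly self-absorbing if it is separable, not isomorphic to `ℂ`,
and there is an isomorphism `D ≅ D ⊗ D` which is approximately unitarily equivalent to the first
factor embedding `d ↦ d ⊗ 1`. -/
structure IsStronglySelfAbsorbing (D : Type u) [CStarAlgebra D] : Prop where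
  separable : TopologicalSpace.SeparableSpace D
  not_complex : IsEmpty (D ≃⋆ₐ[ℂ] ℂ)
  exists_equiv : ∃ φ : D ≃⋆ₐ[ℂ] MinTensor D D,
    ApproxUnitarilyEquiv (φ : D →⋆ₙₐ[ℂ] MinTensor D D) (MinTensor.inl D D : D →⋆ₙₐ[ℂ] _)

end

/-! Elliott's one-sided intertwining argument turns the embedding a ↦ a ⊗ 1 of A into A ⊗ D into an
isomorphism, provided that unitaries of A ⊗ D which almost commute with A ⊗ 1 move any finite subset
of A ⊗ D close to A ⊗ 1. Such unitaries almost fix A ⊗ 1, so it is enough that they move finite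
subsets of 1 ⊗ D there (`MinTensor.exists_unitary_conj`).

In D ⊗ D suitable w exist: 1 ⊗ d = φ(y) for the isomorphism φ : D → D ⊗ D, and w φ(y) w⋆ ≈ y ⊗ 1.
They are carried to A ⊗ D by ψ ⊗ id, where ψ : D → A is unital, completely positive, almost
multiplicative and almost central. Such ψ arise by composing a given almost multiplicative map with
an endomorphism of A whose image almost commutes with a finite set; strong self-absorption of A
provides it (`IsStronglySelfAbsorbing.exists_centralNet`).

Stinespring dilation makes ψ ⊗ id a contraction on minimal tensor products. Hence almost
multiplicativity and centrality pass from elementary tensors to all of D ⊗ D, the image of w is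
almost unitary, and polar decomposition replaces it by a unitary U. Centrality gives U (a ⊗ 1) U⋆ ≈
a ⊗ 1, and multiplicativity gives U (1 ⊗ d) U⋆ ≈ (ψ ⊗ id)(w (1 ⊗ d) w⋆) ≈ ψ(y) ⊗ 1. -/

noncomputable section

/-! ### Stinespring dilation -/

section Stinespring

open scoped InnerProductSpace

variable {D : Type u} [CStarAlgebra D] {H : Type v} [NormedAddCommGroup H] [InnerProductSpace ℂ H]

/-- Complete positivity of an operator-valued linear map, expressed through the positivity of the
kernel `(d, ξ), (d', ξ') ↦ ⟪ξ, ψ (d⋆ d') ξ'⟫`. -/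
structure IsPositiveKernel (ψ : D →ₗ[ℂ] (H →L[ℂ] H)) : Prop where
  inner_star (d : D) (ξ η : H) : ⟪ξ, ψ (star d) η⟫_ℂ = ⟪ψ d ξ, η⟫_ℂ
  re_sum_nonneg (S : Finset (D × H)) :
    0 ≤ (∑ p ∈ S, ∑ q ∈ S, ⟪p.2, ψ (star p.1 * q.1) q.2⟫_ℂ).re

/-- The sesquilinear form `⟪d ⊗ ξ, d' ⊗ ξ'⟫ = ⟪ξ, ψ (d⋆ d') ξ'⟫` on `D ⊗ H`. -/
def stinespringForm (ψ : D →ₗ[ℂ] (H →L[ℂ] H)) : D ⊗[ℂ] H →ₗ⋆[ℂ] D ⊗[ℂ] H →ₗ[ℂ] ℂ :=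
  TensorProduct.lift <| LinearMap.mk₂'ₛₗ (starRingEnd ℂ) (starRingEnd ℂ)
    (fun d ξ => TensorProduct.lift <| LinearMap.mk₂ ℂ (fun d' ξ' => ⟪ξ, ψ (star d * d') ξ'⟫_ℂ)
      (fun a b c => by simp [mul_add])
      (fun a b c => by simp)
      (fun a b c => by simp)
      (fun a b c => by simp))
    (fun a b c => by ext; simp [add_mul])
    (fun a b c => by ext; simp)
    (fun a b c => by ext; simp)
    (fun a b c => by ext; simp [mul_comm])

theorem stinespringForm_tmul (ψ : D →ₗ[ℂ] (H →L[ℂ] H)) (d d' : D) (ξ ξ' : H) :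
    stinespringForm ψ (d ⊗ₜ ξ) (d' ⊗ₜ ξ') = ⟪ξ, ψ (star d * d') ξ'⟫_ℂ := rfl

theorem stinespringForm_conj {ψ : D →ₗ[ℂ] (H →L[ℂ] H)} (hψ : IsPositiveKernel ψ)
    (x y : D ⊗[ℂ] H) : starRingEnd ℂ (stinespringForm ψ y x) = stinespringForm ψ x y := by
  induction x using TensorProduct.induction_on with
  | zero => simp
  | add x x' hx hx' => simp only [map_add, LinearMap.add_apply, hx, hx']
  | tmul a b =>
    induction y using TensorProduct.induction_on with
    | zero => simp
    | add y y' hy hy' => simp only [map_add, LinearMap.add_apply, hy, hy']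
    | tmul c d =>
      rw [stinespringForm_tmul, stinespringForm_tmul, inner_conj_symm, ← hψ.inner_star, star_mul,
        star_star]

theorem stinespringForm_re_nonneg {ψ : D →ₗ[ℂ] (H →L[ℂ] H)} (hψ : IsPositiveKernel ψ)
    (x : D ⊗[ℂ] H) : 0 ≤ (stinespringForm ψ x x).re := by
  obtain ⟨S, rfl⟩ := TensorProduct.exists_finset x
  have h := hψ.re_sum_nonneg S
  rw [Finset.sum_comm] at h
  simpa only [map_sum, LinearMap.sum_apply, stinespringForm_tmul] using! h

theorem stinespringForm_rTensor_mulLeft (ψ : D →ₗ[ℂ] (H →L[ℂ] H)) (a : D) (x y : D ⊗[ℂ] H) :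
    stinespringForm ψ x ((LinearMap.mulLeft ℂ a).rTensor H y) =
      stinespringForm ψ ((LinearMap.mulLeft ℂ (star a)).rTensor H x) y := by
  induction x using TensorProduct.induction_on with
  | zero => simp
  | add x x' hx hx' => simp only [map_add, LinearMap.add_apply, hx, hx']
  | tmul b ξ =>
    induction y using TensorProduct.induction_on with
    | zero => simp
    | add y y' hy hy' => simp only [map_add, hy, hy']
    | tmul c η => simp [stinespringForm_tmul, mul_assoc]

/-- The algebraic tensor product `D ⊗ H` with the semi-inner product `stinespringForm ψ`. -/
def PreStinespring {ψ : D →ₗ[ℂ] (H →L[ℂ] H)} (_ : IsPositiveKernel ψ) : Type (max u v) :=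
  D ⊗[ℂ] H

namespace PreStinespring

variable {ψ : D →ₗ[ℂ] (H →L[ℂ] H)} (hψ : IsPositiveKernel ψ)

instance : AddCommGroup (PreStinespring hψ) := inferInstanceAs (AddCommGroup (D ⊗[ℂ] H))
instance : Module ℂ (PreStinespring hψ) := inferInstanceAs (Module ℂ (D ⊗[ℂ] H))

/-- The semi-inner product of `PreStinespring`. -/
abbrev core : PreInnerProductSpace.Core ℂ (PreStinespring hψ) where
  inner x y := stinespringForm ψ x y
  conj_inner_symm x y := stinespringForm_conj hψ x y
  re_inner_nonneg x := stinespringForm_re_nonneg hψ x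
  add_left x y z := LinearMap.map_add₂ (stinespringForm ψ) x y z
  smul_left x y c := LinearMap.map_smulₛₗ₂ (stinespringForm ψ) c x y

instance : SeminormedAddCommGroup (PreStinespring hψ) :=
  InnerProductSpace.Core.toSeminormedAddCommGroup (c := core hψ)
instance : InnerProductSpace ℂ (PreStinespring hψ) := InnerProductSpace.ofCore (core hψ)

/-- Left multiplication as a linear map. -/
def mulₗ (a : D) : PreStinespring hψ →ₗ[ℂ] PreStinespring hψ :=
  (LinearMap.mulLeft ℂ a).rTensor H

theorem inner_mulₗ (a : D) (x y : PreStinespring hψ) :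
    ⟪x, mulₗ hψ a y⟫_ℂ = ⟪mulₗ hψ (star a) x, y⟫_ℂ :=
  stinespringForm_rTensor_mulLeft ψ a x y

theorem mulₗ_mul (a b : D) : mulₗ hψ (a * b) = mulₗ hψ a ∘ₗ mulₗ hψ b := by
  rw [mulₗ, LinearMap.mulLeft_mul]
  exact LinearMap.rTensor_comp H _ _

theorem mulₗ_one : mulₗ hψ 1 = LinearMap.id := by
  rw [mulₗ, LinearMap.mulLeft_one]
  exact LinearMap.rTensor_id H D

theorem mulₗ_add (a b : D) : mulₗ hψ (a + b) = mulₗ hψ a + mulₗ hψ b := by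
  have : LinearMap.mulLeft ℂ (a + b) = LinearMap.mulLeft ℂ a + LinearMap.mulLeft ℂ b :=
    map_add (LinearMap.mul ℂ D) a b
  rw [mulₗ, this]
  exact LinearMap.rTensor_add H _ _

theorem mulₗ_smul (c : ℂ) (a : D) : mulₗ hψ (c • a) = c • mulₗ hψ a := by
  have : LinearMap.mulLeft ℂ (c • a) = c • LinearMap.mulLeft ℂ a :=
    map_smul (LinearMap.mul ℂ D) c a
  rw [mulₗ, this]
  exact LinearMap.rTensor_smul H _ _

/-- Writing ‖a‖² - a⋆a = c⋆c gives ‖c x‖² + ‖a x‖² = ‖a‖² ‖x‖², and the first summand is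
non-negative. -/
theorem norm_mulₗ_le (a : D) (x : PreStinespring hψ) : ‖mulₗ hψ a x‖ ≤ ‖a‖ * ‖x‖ := by
  let := CStarAlgebra.spectralOrder D
  let := CStarAlgebra.spectralOrderedRing D
  have hle : star a * a ≤ algebraMap ℂ D ((‖a‖ ^ 2 : ℝ) : ℂ) := by
    have := IsSelfAdjoint.le_algebraMap_norm_self (IsSelfAdjoint.star_mul_self a)
    rw [CStarRing.norm_star_mul_self, ← sq] at this
    exact this
  obtain ⟨c, hc⟩ := CStarAlgebra.nonneg_iff_eq_star_mul_self.mp (sub_nonneg.mpr hle)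
  have key : ∀ b : D, ‖mulₗ hψ b x‖ ^ 2 = (⟪x, mulₗ hψ (star b * b) x⟫_ℂ).re := fun b => by
    rw [mulₗ_mul, LinearMap.comp_apply, inner_mulₗ, star_star]
    exact norm_sq_eq_re_inner (𝕜 := ℂ) _
  have hsum : star c * c + star a * a = ((‖a‖ ^ 2 : ℝ) : ℂ) • (1 : D) := by
    rw [← hc, sub_add_cancel, Algebra.algebraMap_eq_smul_one]
  have h1 : ‖mulₗ hψ c x‖ ^ 2 + ‖mulₗ hψ a x‖ ^ 2 = ‖a‖ ^ 2 * ‖x‖ ^ 2 := by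
    rw [key, key, ← Complex.add_re, ← inner_add_right, ← LinearMap.add_apply, ← mulₗ_add, hsum,
      mulₗ_smul, mulₗ_one, LinearMap.smul_apply, inner_smul_right, Complex.re_ofReal_mul,
      LinearMap.id_apply]
    congr 1
    exact (norm_sq_eq_re_inner (𝕜 := ℂ) _).symm
  refine le_of_sq_le_sq ?_ (by positivity)
  rw [mul_pow]
  nlinarith [sq_nonneg ‖mulₗ hψ c x‖]

/-- Left multiplication as a bounded operator. -/
def mulL (a : D) : PreStinespring hψ →L[ℂ] PreStinespring hψ :=
  (mulₗ hψ a).mkContinuous ‖a‖ (norm_mulₗ_le hψ a)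

theorem mulL_apply (a : D) (x : PreStinespring hψ) : mulL hψ a x = mulₗ hψ a x := rfl

theorem completion_ext {S T : Completion (PreStinespring hψ) →L[ℂ] Completion (PreStinespring hψ)}
    (h : ∀ x : PreStinespring hψ, S x = T x) : S = T := by
  ext x
  induction x using Completion.induction_on with
  | hp => exact isClosed_eq S.continuous T.continuous
  | ih x => exact h x

/-- The Stinespring representation. -/
def rep : D →⋆ₐ[ℂ] (Completion (PreStinespring hψ) →L[ℂ] Completion (PreStinespring hψ)) where
  toFun a := (mulL hψ a).completion
  map_one' := completion_ext hψ fun x => by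
    rw [ContinuousLinearMap.completion_apply_coe, mulL_apply, mulₗ_one]; rfl
  map_zero' := completion_ext hψ fun x => by
    have : mulₗ hψ 0 = 0 := by simpa using mulₗ_smul hψ 0 0
    rw [ContinuousLinearMap.completion_apply_coe, mulL_apply, this]; rfl
  map_add' a b := completion_ext hψ fun x => by
    simp only [ContinuousLinearMap.completion_apply_coe, mulL_apply, mulₗ_add,
      LinearMap.add_apply, Completion.coe_add, _root_.add_apply]
  map_mul' a b := completion_ext hψ fun x => by
    simp only [ContinuousLinearMap.completion_apply_coe, mulL_apply, mulₗ_mul,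
      LinearMap.comp_apply, mul_apply_eq_comp]
  commutes' c := completion_ext hψ fun x => by
    rw [Algebra.algebraMap_eq_smul_one, Algebra.algebraMap_eq_smul_one,
      ContinuousLinearMap.completion_apply_coe, mulL_apply, mulₗ_smul, mulₗ_one]
    exact Completion.coe_smul c x
  map_star' a := by
    refine (ContinuousLinearMap.eq_adjoint_iff _ _).mpr fun x y => ?_
    induction x, y using Completion.induction_on₂ with
    | hp => apply isClosed_eq <;> fun_prop
    | ih x y =>
      rw [ContinuousLinearMap.completion_apply_coe, ContinuousLinearMap.completion_apply_coe,
        Completion.inner_coe, Completion.inner_coe, mulL_apply, mulL_apply, inner_mulₗ]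

theorem rep_coe (a : D) (x : PreStinespring hψ) :
    rep hψ a (x : Completion (PreStinespring hψ)) = mulₗ hψ a x :=
  ContinuousLinearMap.completion_apply_coe _ _

/-- The vector `d ⊗ ξ`. -/
def tmul (d : D) (ξ : H) : PreStinespring hψ := d ⊗ₜ[ℂ] ξ

theorem inner_tmul (d d' : D) (ξ ξ' : H) :
    ⟪tmul hψ d ξ, tmul hψ d' ξ'⟫_ℂ = ⟪ξ, ψ (star d * d') ξ'⟫_ℂ := rfl

theorem mulₗ_tmul (a d : D) (ξ : H) : mulₗ hψ a (tmul hψ d ξ) = tmul hψ (a * d) ξ := rfl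

/-- The isometry `ξ ↦ 1 ⊗ ξ` of the Stinespring dilation of a unital map. -/
def isometry (h1 : ψ 1 = 1) : H →ₗᵢ[ℂ] Completion (PreStinespring hψ) :=
  LinearMap.isometryOfInner
    ((Completion.toComplₗᵢ (𝕜 := ℂ) (E := PreStinespring hψ)).toLinearMap ∘ₗ
      (TensorProduct.mk ℂ D H 1 : H →ₗ[ℂ] D ⊗[ℂ] H)) fun ξ η => by
    refine (Completion.inner_coe (tmul hψ 1 ξ) (tmul hψ 1 η)).trans ?_
    rw [inner_tmul, star_one, mul_one, h1]; rfl

theorem isometry_apply (h1 : ψ 1 = 1) (ξ : H) :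
    isometry hψ h1 ξ = (tmul hψ 1 ξ : Completion (PreStinespring hψ)) := rfl

theorem inner_isometry (h1 : ψ 1 = 1) (d : D) (ξ η : H) :
    ⟪isometry hψ h1 ξ, rep hψ d (isometry hψ h1 η)⟫_ℂ = ⟪ξ, ψ d η⟫_ℂ := by
  rw [isometry_apply, isometry_apply, rep_coe, Completion.inner_coe, mulₗ_tmul, inner_tmul,
    star_one, one_mul, mul_one]

end PreStinespring

end Stinespring

/-! ### Dilatable maps -/

section Dilatable

open scoped InnerProductSpace

/-- A linear map `ψ : D → A` of C⋆-algebras is dilatable if for every representation `π` of `A`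
the map `π ∘ ψ` is the compression of a representation of `D` to a subspace. -/
def IsDilatable {D A : Type u} [CStarAlgebra D] [CStarAlgebra A] (ψ : D →ₗ[ℂ] A) : Prop :=
  ∀ (H : Type u) [NormedAddCommGroup H] [InnerProductSpace ℂ H] [CompleteSpace H]
    (π : A →⋆ₐ[ℂ] (H →L[ℂ] H)),
    ∃ (K : Type u) (_ : NormedAddCommGroup K) (_ : InnerProductSpace ℂ K) (_ : CompleteSpace K)
      (σ : D →⋆ₐ[ℂ] (K →L[ℂ] K)) (V : H →ₗᵢ[ℂ] K),
      ∀ d ξ η, ⟪V ξ, σ d (V η)⟫_ℂ = ⟪ξ, π (ψ d) η⟫_ℂ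

variable {D A : Type u} [CStarAlgebra D] [CStarAlgebra A]

theorem IsDilatable.comp_starAlgHom {B : Type u} [CStarAlgebra B] {ψ : D →ₗ[ℂ] A}
    (hψ : IsDilatable ψ) (g : A →⋆ₐ[ℂ] B) :
    IsDilatable (g.toAlgHom.toLinearMap ∘ₗ ψ) := fun H _ _ _ π => hψ H (π.comp g)

theorem exists_eq_star_mul_self_of_nonneg {B : Type*} [NonUnitalCStarAlgebra B] [PartialOrder B]
    [StarOrderedRing B] {a : B} (ha : 0 ≤ a) : ∃ b, a = star b * b :=
  CStarAlgebra.nonneg_iff_eq_star_mul_self.mp ha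

/-- The matrix (dᵢ⋆ dⱼ) has the form N⋆N, so its entrywise image under φ has the form P⋆P. The
kernel sum then becomes ∑ₖ ‖∑ᵢ π(Pₖᵢ) ξᵢ‖². -/
theorem CompletelyPositiveMap.isPositiveKernel [PartialOrder D] [StarOrderedRing D]
    [PartialOrder A] [StarOrderedRing A] (φ : CompletelyPositiveMap D A)
    {H : Type v} [NormedAddCommGroup H] [InnerProductSpace ℂ H] [CompleteSpace H]
    (π : A →⋆ₐ[ℂ] (H →L[ℂ] H)) :
    IsPositiveKernel (π.toAlgHom.toLinearMap ∘ₗ (φ : D →ₗ[ℂ] A)) where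
  inner_star d ξ η := by
    change ⟪ξ, π (φ (star d)) η⟫_ℂ = ⟪π (φ d) ξ, η⟫_ℂ
    rw [map_star, map_star, ContinuousLinearMap.star_eq_adjoint,
      ContinuousLinearMap.adjoint_inner_right]
  re_sum_nonneg S := by
    classical
    change 0 ≤ (∑ p ∈ S, ∑ q ∈ S, ⟪p.2, π (φ (star p.1 * q.1)) q.2⟫_ℂ).re
    rcases S.eq_empty_or_nonempty with rfl | ⟨s, hs⟩
    · simp
    -- A single row of entries dⱼ would suffice; it is padded with zero rows to a square matrix, so
    -- that N⋆N lies in a matrix algebra. The index `s` of the non-zero row is arbitrary.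
    let N : CStarMatrix S S D := CStarMatrix.ofMatrix fun i j => if i = ⟨s, hs⟩ then j.1.1 else 0
    have hN : ∀ i j, N i j = if i = ⟨s, hs⟩ then j.1.1 else 0 := fun _ _ => rfl
    have hM := φ.map_cstarMatrix_nonneg (star N * N) (star_mul_self_nonneg N)
    obtain ⟨P, hP⟩ := exists_eq_star_mul_self_of_nonneg hM
    have hφ : ∀ i j : S, φ (star i.1.1 * j.1.1) = ∑ k, star (P k i) * P k j := fun i j => by
      have h1 : (star N * N) i j = star i.1.1 * j.1.1 := by
        rw [CStarMatrix.mul_apply, Finset.sum_eq_single (⟨s, hs⟩ : S)]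
        · rw [CStarMatrix.star_apply, hN, hN, if_pos rfl, if_pos rfl]
        · intro b _ hb
          rw [hN b, if_neg hb, mul_zero]
        · simp
      rw [← h1]
      refine (congrArg (fun M : CStarMatrix S S A => M i j) hP).trans ?_
      rw [CStarMatrix.mul_apply]
      rfl
    rw [← Finset.sum_coe_sort S]
    simp_rw [← Finset.sum_coe_sort S]
    have hsum : ∑ i : S, ∑ j : S, ⟪i.1.2, π (φ (star i.1.1 * j.1.1)) j.1.2⟫_ℂ =
        ∑ k : S, ⟪∑ i : S, π (P k i) i.1.2, ∑ j : S, π (P k j) j.1.2⟫_ℂ := by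
      simp_rw [hφ, map_sum, map_mul, map_star, _root_.sum_apply, inner_sum, sum_inner,
        mul_apply_eq_comp, ContinuousLinearMap.star_eq_adjoint,
        ContinuousLinearMap.adjoint_inner_right]
      rw [Finset.sum_comm]
      conv_lhs => enter [2, x]; rw [Finset.sum_comm]
      rw [Finset.sum_comm]
    rw [hsum, Complex.re_sum]
    exact Finset.sum_nonneg fun k _ => inner_self_nonneg (𝕜 := ℂ)

theorem CompletelyPositiveMap.isDilatable [PartialOrder D] [StarOrderedRing D]
    [PartialOrder A] [StarOrderedRing A] (φ : CompletelyPositiveMap D A) (h1 : φ 1 = 1) :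
    IsDilatable (φ : D →ₗ[ℂ] A) := fun H _ _ _ π => by
  have hk := φ.isPositiveKernel π
  have hone : (π.toAlgHom.toLinearMap ∘ₗ (φ : D →ₗ[ℂ] A)) 1 = 1 := by
    change π (φ 1) = 1
    rw [h1, map_one]
  exact ⟨Completion (PreStinespring hk), inferInstance, inferInstance, inferInstance,
    PreStinespring.rep hk, PreStinespring.isometry hk hone, PreStinespring.inner_isometry hk hone⟩

end Dilatable

theorem StarAlgHom.continuous_of_cstar {A B : Type*} [CStarAlgebra A] [CStarAlgebra B]
    (f : A →⋆ₐ[ℂ] B) : Continuous f :=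
  AddMonoidHomClass.continuous_of_bound f 1 fun a => by
    simpa only [one_mul] using NonUnitalStarAlgHom.norm_apply_le f a

/-! ### Tensoring a dilatable map with the identity -/

section MapLeft

open scoped InnerProductSpace

variable {D A : Type u} [CStarAlgebra D] [CStarAlgebra A] {E : Type v} [CStarAlgebra E]

/-- The map `ψ ⊗ id` on algebraic tensor products. -/
def AlgTensor.mapLeft (E : Type v) [CStarAlgebra E] (ψ : D →ₗ[ℂ] A) :
    AlgTensor D E →ₗ[ℂ] AlgTensor A E :=
  (LinearMap.rTensor E ψ : D ⊗[ℂ] E →ₗ[ℂ] A ⊗[ℂ] E)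

theorem AlgTensor.mapLeft_tmul (ψ : D →ₗ[ℂ] A) (d : D) (e : E) :
    AlgTensor.mapLeft E ψ (AlgTensor.tmul d e) = AlgTensor.tmul (ψ d) e := rfl

/-- With W = V ⊗ 1, the operator (π ⊗ ρ)((ψ ⊗ id) x) is the compression W⋆ (σ ⊗ ρ)(x) W, and σ ⊗ ρ
is one of the representations defining the norm of x. -/
theorem IsDilatable.norm_rep_mapLeft_le {ψ : D →ₗ[ℂ] A} (hψ : IsDilatable ψ) (p : RepPair A E)
    (x : AlgTensor D E) : ‖p.rep (AlgTensor.mapLeft E ψ x)‖ ≤ ‖x‖ := by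
  obtain ⟨K, _, _, _, σ, V, hV⟩ := hψ p.H p.π
  let q : RepPair D E := { H := K, K := p.K, π := σ, ρ := p.ρ }
  let W : p.H ⊗[ℂ] p.K →ₗᵢ[ℂ] K ⊗[ℂ] p.K := V.rTensor p.K
  have key : ∀ z w : p.H ⊗[ℂ] p.K,
      ⟪HilbertTensor.of z, p.rep (AlgTensor.mapLeft E ψ x) (HilbertTensor.of w)⟫_ℂ =
        ⟪HilbertTensor.of (W z), q.rep x (HilbertTensor.of (W w))⟫_ℂ := by
    intro z w
    induction x using AlgTensor.induction_on with
    | zero => simp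
    | add x y hx hy =>
      simp only [map_add, _root_.add_apply, inner_add_right, hx, hy]
    | tmul d e =>
      rw [AlgTensor.mapLeft_tmul, RepPair.rep_tmul, RepPair.rep_tmul, opTensor_of, opTensor_of,
        LinearIsometry.inner_map_map, LinearIsometry.inner_map_map]
      induction z using TensorProduct.induction_on with
      | zero => simp
      | add z z' hz hz' => simp only [map_add, inner_add_left, hz, hz']
      | tmul a b =>
        induction w using TensorProduct.induction_on with
        | zero => simp
        | add w w' hw hw' => simp only [map_add, inner_add_right, hw, hw']
        | tmul a' b' =>
          change ⟪a ⊗ₜ[ℂ] b, (p.π (ψ d) a') ⊗ₜ[ℂ] (p.ρ e b')⟫_ℂ =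
            ⟪V a ⊗ₜ[ℂ] b, (σ d (V a')) ⊗ₜ[ℂ] (p.ρ e b')⟫_ℂ
          rw [TensorProduct.inner_tmul, TensorProduct.inner_tmul, hV]
  refine ContinuousLinearMap.opNorm_le_bound _ (AlgTensor.norm_nonneg' x) fun ζ => ?_
  -- Taking ω to be the vector itself and cancelling one factor of its norm recovers the norm bound.
  suffices h : ∀ ω, ‖⟪ω, p.rep (AlgTensor.mapLeft E ψ x) ζ⟫_ℂ‖ ≤ ‖ω‖ * (‖x‖ * ‖ζ‖) by
    have h' := h (p.rep (AlgTensor.mapLeft E ψ x) ζ)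
    rw [inner_self_eq_norm_sq_to_K, norm_pow, RCLike.norm_ofReal, abs_norm, sq] at h'
    rcases (norm_nonneg (p.rep (AlgTensor.mapLeft E ψ x) ζ)).eq_or_lt with h0 | h0
    · rw [← h0]
      exact mul_nonneg (AlgTensor.norm_nonneg' x) (norm_nonneg ζ)
    · exact le_of_mul_le_mul_left h' h0
  intro ω
  induction ω using HilbertTensor.induction_on with
  | hp => apply isClosed_le <;> fun_prop
  | ih z =>
    induction ζ using HilbertTensor.induction_on with
    | hp => apply isClosed_le <;> fun_prop
    | ih w =>
      rw [key]
      refine (norm_inner_le_norm _ _).trans ?_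
      rw [LinearIsometry.norm_map, LinearIsometry.norm_map, LinearIsometry.norm_map]
      refine mul_le_mul_of_nonneg_left ?_ (norm_nonneg _)
      refine (ContinuousLinearMap.le_opNorm _ _).trans ?_
      rw [LinearIsometry.norm_map, LinearIsometry.norm_map, LinearIsometry.norm_map]
      exact mul_le_mul_of_nonneg_right (AlgTensor.norm_rep_le q x) (norm_nonneg _)

theorem IsDilatable.norm_algTensor_mapLeft_le {ψ : D →ₗ[ℂ] A} (hψ : IsDilatable ψ)
    (x : AlgTensor D E) : ‖AlgTensor.mapLeft E ψ x‖ ≤ ‖x‖ :=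
  AlgTensor.norm_le (AlgTensor.norm_nonneg' x) fun p => hψ.norm_rep_mapLeft_le p x

/-- The contraction `ψ ⊗ id` on minimal tensor products, for a dilatable map `ψ`. -/
def IsDilatable.mapLeft (E : Type v) [CStarAlgebra E] {ψ : D →ₗ[ℂ] A} (hψ : IsDilatable ψ) :
    MinTensor D E →L[ℂ] MinTensor A E :=
  (((AlgTensor.mapLeft E ψ).mkContinuous 1 fun x => by
    simpa only [one_mul] using hψ.norm_algTensor_mapLeft_le x).completion :
    Completion (AlgTensor D E) →L[ℂ] Completion (AlgTensor A E))

theorem IsDilatable.mapLeft_ofAlg {ψ : D →ₗ[ℂ] A} (hψ : IsDilatable ψ) (x : AlgTensor D E) :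
    hψ.mapLeft E (MinTensor.ofAlg x) = MinTensor.ofAlg (AlgTensor.mapLeft E ψ x) :=
  ContinuousLinearMap.completion_apply_coe _ _

theorem IsDilatable.mapLeft_tmul {ψ : D →ₗ[ℂ] A} (hψ : IsDilatable ψ) (d : D) (e : E) :
    hψ.mapLeft E (MinTensor.tmul d e) = MinTensor.tmul (ψ d) e :=
  hψ.mapLeft_ofAlg _

theorem IsDilatable.norm_mapLeft_le {ψ : D →ₗ[ℂ] A} (hψ : IsDilatable ψ) (x : MinTensor D E) :
    ‖hψ.mapLeft E x‖ ≤ ‖x‖ := by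
  induction x using MinTensor.induction_on with
  | hp => apply isClosed_le <;> fun_prop
  | ih x =>
    rw [hψ.mapLeft_ofAlg, MinTensor.norm_ofAlg, MinTensor.norm_ofAlg]
    exact hψ.norm_algTensor_mapLeft_le x

end MapLeft

/-! ### Elementary tensors and separability of the minimal tensor product -/

namespace MinTensor

variable {A : Type u} {B : Type v} [CStarAlgebra A] [CStarAlgebra B]

theorem tmul_mul_tmul (a a' : A) (b b' : B) :
    tmul a b * tmul a' b' = tmul (a * a') (b * b') := by
  rw [tmul, tmul, tmul, ← ofAlg_mul, AlgTensor.tmul_mul_tmul]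

theorem star_tmul (a : A) (b : B) : star (tmul a b) = tmul (star a) (star b) := by
  rw [tmul, tmul, star_ofAlg, AlgTensor.star_tmul]

theorem add_tmul (a a' : A) (b : B) : tmul (a + a') b = tmul a b + tmul a' b :=
  (congrArg ofAlg (TensorProduct.add_tmul a a' b)).trans (ofAlg_add _ _)

theorem sub_tmul (a a' : A) (b : B) : tmul (a - a') b = tmul a b - tmul a' b := by
  rw [eq_sub_iff_add_eq, ← add_tmul, sub_add_cancel]

theorem norm_tmul_le (a : A) (b : B) : ‖tmul a b‖ ≤ ‖a‖ * ‖b‖ := by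
  rw [tmul, norm_ofAlg]
  refine AlgTensor.norm_le (by positivity) fun p => ?_
  rw [p.rep_tmul]
  exact (norm_opTensor_le _ _).trans (mul_le_mul (NonUnitalStarAlgHom.norm_apply_le p.π a)
    (NonUnitalStarAlgHom.norm_apply_le p.ρ b) (norm_nonneg _) (norm_nonneg _))

theorem inl_apply (a : A) : inl A B a = tmul a 1 := rfl

/-- The second factor embedding `b ↦ 1 ⊗ b`. -/
def inr (A : Type u) (B : Type v) [CStarAlgebra A] [CStarAlgebra B] : B →⋆ₐ[ℂ] MinTensor A B where
  toFun b := tmul 1 b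
  map_one' := rfl
  map_zero' := congrArg ofAlg (TensorProduct.tmul_zero B (1 : A))
  map_add' b b' := (congrArg ofAlg (TensorProduct.tmul_add (1 : A) b b')).trans (ofAlg_add _ _)
  map_mul' b b' := by rw [tmul_mul_tmul, one_mul]
  commutes' c := by
    rw [Algebra.algebraMap_eq_smul_one, Algebra.algebraMap_eq_smul_one]
    exact (congrArg ofAlg (TensorProduct.tmul_smul c (1 : A) (1 : B))).trans (ofAlg_smul c 1)
  map_star' b := by rw [star_tmul, star_one]

theorem inr_apply (b : B) : inr A B b = tmul 1 b := rfl

theorem inl_mul_inr (a : A) (b : B) : inl A B a * inr A B b = tmul a b := by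
  rw [inl_apply, inr_apply, tmul_mul_tmul, mul_one, one_mul]

theorem inr_mul_inl (a : A) (b : B) : inr A B b * inl A B a = tmul a b := by
  rw [inl_apply, inr_apply, tmul_mul_tmul, mul_one, one_mul]

/-- A closed additive property of elements of the minimal tensor product holds if it holds for
elementary tensors. -/
theorem induction_tmul {p : MinTensor A B → Prop} (hp : IsClosed {x | p x})
    (add : ∀ x y, p x → p y → p (x + y)) (tmul : ∀ a b, p (tmul a b)) (x : MinTensor A B) :
    p x := by
  induction x using induction_on with
  | hp => exact hp
  | ih x =>
    induction x using AlgTensor.induction_on with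
    | zero =>
      -- Zero needs no hypothesis of its own, being the elementary tensor 0 ⊗ 0.
      have := tmul 0 0
      rwa [MinTensor.tmul, AlgTensor.tmul, TensorProduct.zero_tmul] at this
    | add x y hx hy => rw [ofAlg_add]; exact add _ _ hx hy
    | tmul a b => exact tmul a b

theorem separableSpace [TopologicalSpace.SeparableSpace A] [TopologicalSpace.SeparableSpace B] :
    TopologicalSpace.SeparableSpace (MinTensor A B) := by
  let s : Set (MinTensor A B) :=
    Set.range fun p : ℕ × ℕ =>
      tmul (TopologicalSpace.denseSeq A p.1) (TopologicalSpace.denseSeq B p.2)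
  have hsep : TopologicalSpace.IsSeparable
      (Submodule.span ℂ s : Set (MinTensor A B)) :=
    (Set.countable_range _).isSeparable.span (R := ℂ)
  have hcl : TopologicalSpace.IsSeparable
      (closure (Submodule.span ℂ s : Set (MinTensor A B))) := hsep.closure
  have htop : closure (Submodule.span ℂ s : Set (MinTensor A B)) = Set.univ := by
    refine Set.eq_univ_of_forall fun x => ?_
    refine induction_tmul (p := fun x => x ∈ closure (Submodule.span ℂ s : Set (MinTensor A B)))
      isClosed_closure (fun x y hx hy => ?_) (fun a b => ?_) x
    · exact (Submodule.span ℂ s).topologicalClosure.add_mem hx hy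
    · have hc : Continuous fun q : A × B => (tmul q.1 q.2 : MinTensor A B) := by
        have : (fun q : A × B => (tmul q.1 q.2 : MinTensor A B)) =
            fun q => inl A B q.1 * inr A B q.2 := by
          ext q; rw [inl_mul_inr]
        rw [this]
        exact (((inl A B).continuous_of_cstar).comp continuous_fst).mul
          (((inr A B).continuous_of_cstar).comp continuous_snd)
      have hd := (TopologicalSpace.denseRange_denseSeq A).prodMap
        (TopologicalSpace.denseRange_denseSeq B)
      refine closure_mono ?_ (map_mem_closure (x := (a, b)) hc (hd (a, b)) (t := s) ?_)
      · exact Submodule.subset_span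
      · rintro _ ⟨p, rfl⟩
        exact ⟨p, rfl⟩
  rw [htop] at hcl
  exact TopologicalSpace.isSeparable_univ_iff.mp hcl

end MinTensor

/-! ### Unitaries close to approximate unitaries -/

/-- On the spectrum t ≥ 0, hence |1 - t| ≤ |1 - t| (1 + t) = |1 - t²|. -/
theorem CStarAlgebra.norm_one_sub_le_norm_one_sub_mul_self {B : Type*} [CStarAlgebra B]
    [PartialOrder B] [StarOrderedRing B] {a : B} (ha : 0 ≤ a) : ‖1 - a‖ ≤ ‖1 - a * a‖ := by
  have hsa : IsSelfAdjoint a := ha.isSelfAdjoint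
  have h1 : cfc (fun t : ℝ => 1 - t) a = 1 - a := by
    rw [cfc_sub _ _ a, cfc_const_one ℝ a, cfc_id' ℝ a]
  have h2 : cfc (fun t : ℝ => 1 - t * t) a = 1 - a * a := by
    rw [cfc_sub _ _ a, cfc_const_one ℝ a, cfc_mul _ _ a, cfc_id' ℝ a]
  rw [← h1]
  refine norm_cfc_le (norm_nonneg _) fun t ht => ?_
  have h0 : 0 ≤ t := spectrum_nonneg_of_nonneg ha ht
  refine le_trans ?_ (h2 ▸ norm_apply_le_norm_cfc (fun t : ℝ => 1 - t * t) a ht)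
  have h3 : 1 - t * t = (1 - t) * (1 + t) := by ring
  rw [h3, norm_mul]
  refine le_mul_of_one_le_right (norm_nonneg _) ?_
  rw [Real.norm_of_nonneg (by linarith)]
  linarith

/-- Polar decomposition: both hypotheses together make x invertible, so w = x|x|⁻¹ is unitary and ‖w
- x‖ = ‖w(1 - |x|)‖ = ‖1 - |x|‖. -/
theorem exists_unitary_norm_sub_le {B : Type*} [CStarAlgebra B] {x : B}
    (h : ‖1 - star x * x‖ < 1) (h' : ‖1 - x * star x‖ < 1) :
    ∃ w : unitary B, ‖(w : B) - x‖ ≤ ‖1 - star x * x‖ := by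
  let := CStarAlgebra.spectralOrder B
  let := CStarAlgebra.spectralOrderedRing B
  have hu : IsUnit (star x * x) := by
    simpa using isUnit_one_sub_of_norm_lt_one h
  have hu' : IsUnit (x * star x) := by
    simpa using isUnit_one_sub_of_norm_lt_one h'
  have hx : IsUnit x := by
    obtain ⟨y, hy⟩ := hu.exists_left_inv
    obtain ⟨z, hz⟩ := hu'.exists_right_inv
    exact isUnit_iff_exists_and_exists.mpr
      ⟨⟨star x * z, by rw [← mul_assoc, hz]⟩, ⟨y * star x, by rw [mul_assoc, hy]⟩⟩
  have hpos : 0 ≤ star x * x := star_mul_self_nonneg x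
  obtain ⟨a, ha0, ha⟩ := CStarAlgebra.nonneg_iff_exists_nonneg_and_eq_mul_self.mp hpos
  have hsa : star a = a := ha0.isSelfAdjoint
  have hau : IsUnit a := by
    rw [ha] at hu
    obtain ⟨y, hy⟩ := hu.exists_left_inv
    obtain ⟨z, hz⟩ := hu.exists_right_inv
    exact isUnit_iff_exists_and_exists.mpr
      ⟨⟨a * z, by rw [← mul_assoc, hz]⟩, ⟨y * a, by rw [mul_assoc, hy]⟩⟩
  obtain ⟨a, rfl⟩ := hau
  have hinv : star (↑a⁻¹ : B) = ↑a⁻¹ := by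
    rw [← Units.coe_star_inv, inv_inj.mpr (Units.ext hsa : star a = a)]
  have h1 : star (x * ↑a⁻¹) * (x * ↑a⁻¹) = 1 := by
    rw [star_mul, hinv, mul_assoc, ← mul_assoc (star x), ha, mul_assoc, Units.mul_inv, mul_one,
      Units.inv_mul]
  have hxa : IsUnit (x * ↑a⁻¹) := hx.mul (Units.isUnit _)
  have h2 : (x * ↑a⁻¹) * star (x * ↑a⁻¹) = 1 := by
    obtain ⟨z, hz⟩ := hxa.exists_right_inv
    rwa [left_inv_eq_right_inv h1 hz]
  refine ⟨⟨x * ↑a⁻¹, h1, h2⟩, ?_⟩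
  have h3 : x * ↑a⁻¹ - x = (x * ↑a⁻¹) * (1 - (a : B)) := by
    rw [mul_sub, mul_one, mul_assoc, Units.inv_mul, mul_one]
  change ‖x * ↑a⁻¹ - x‖ ≤ _
  rw [h3, ha]
  have h4 := CStarRing.norm_mem_unitary_mul (1 - (a : B))
    (show x * ↑a⁻¹ ∈ unitary B from ⟨h1, h2⟩)
  rw [h4]
  exact CStarAlgebra.norm_one_sub_le_norm_one_sub_mul_self ha0

/-! ### One-sided approximate intertwining -/

section Intertwining

variable {A : Type u} {B : Type v} [CStarAlgebra A] [CStarAlgebra B]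

/-- The pointwise limit of a sequence of ⋆-homomorphisms. -/
def StarAlgHom.ofTendsto (f : ℕ → A →⋆ₐ[ℂ] B) (g : A → B)
    (h : ∀ a, Tendsto (fun n => f n a) atTop (𝓝 (g a))) : A →⋆ₐ[ℂ] B where
  toFun := g
  map_one' := tendsto_nhds_unique (h 1) (by simp only [map_one]; exact tendsto_const_nhds)
  map_zero' := tendsto_nhds_unique (h 0) (by simp only [map_zero]; exact tendsto_const_nhds)
  map_add' a b := tendsto_nhds_unique (h (a + b))
    (by simp only [map_add]; exact (h a).add (h b))
  map_mul' a b := tendsto_nhds_unique (h (a * b))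
    (by simp only [map_mul]; exact (h a).mul (h b))
  commutes' c := tendsto_nhds_unique (h (algebraMap ℂ A c))
    (by simp only [AlgHomClass.commutes]; exact tendsto_const_nhds)
  map_star' a := tendsto_nhds_unique (h (star a))
    (by simp only [map_star]; exact (h a).star)

theorem norm_conj_unitary (w : unitary B) (x : B) : ‖(w : B) * x * star (w : B)‖ = ‖x‖ :=
  StarAlgEquiv.norm_map (Unitary.conjStarAlgAut ℂ B w) x

theorem cauchySeq_of_dense {f : ℕ → A → B} (hf : ∀ n a b, ‖f n a - f n b‖ = ‖a - b‖)
    {s : Set A} (hs : Dense s) (h : ∀ a ∈ s, CauchySeq fun n => f n a) (a : A) :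
    CauchySeq fun n => f n a := by
  refine Metric.cauchySeq_iff'.mpr fun ε hε => ?_
  obtain ⟨b, hb, hab⟩ := hs.exists_dist_lt a (show 0 < ε / 3 by positivity)
  obtain ⟨N, hN⟩ := Metric.cauchySeq_iff'.mp (h b hb) (ε / 3) (by positivity)
  refine ⟨N, fun n hn => ?_⟩
  have h1 : dist (f n a) (f n b) < ε / 3 := by rw [dist_eq_norm, hf, ← dist_eq_norm]; exact hab
  have h2 : dist (f N b) (f N a) < ε / 3 := by
    rw [dist_eq_norm, hf, ← dist_eq_norm, dist_comm]; exact hab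
  linarith [hN n hn, dist_triangle4 (f n a) (f n b) (f N b) (f N a)]

/-- Elliott's one-sided approximate intertwining argument: an isometric ⋆-homomorphism `σ : A → B`
of separable C⋆-algebras is approximately unitarily equivalent to an isomorphism if unitaries of
`B` that almost commute with `σ A` move any finite subset of `B` close to `σ A`. -/
theorem nonempty_starAlgEquiv_of_intertwining [TopologicalSpace.SeparableSpace A]
    [TopologicalSpace.SeparableSpace B] (σ : A →⋆ₐ[ℂ] B) (hσ : ∀ a, ‖σ a‖ = ‖a‖)
    (h : ∀ (F : Finset A) (G : Finset B) (ε : ℝ), 0 < ε → ∃ w : unitary B,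
      (∀ a ∈ F, ‖(w : B) * σ a * star (w : B) - σ a‖ < ε) ∧
      ∀ b ∈ G, ∃ a, ‖(w : B) * b * star (w : B) - σ a‖ < ε) :
    Nonempty (A ≃⋆ₐ[ℂ] B) := by
  classical
  let c : unitary B → B ≃⋆ₐ[ℂ] B := fun w => Unitary.conjStarAlgAut ℂ B w
  have hc : ∀ w x, ‖c w x‖ = ‖x‖ := fun w x => StarAlgEquiv.norm_map (c w) x
  let α := TopologicalSpace.denseSeq A
  let β := TopologicalSpace.denseSeq B
  -- The state is a unitary W with a finite set F on which the current map Ad(W) ∘ σ must be nearly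
  -- preserved from now on. The hypothesis, applied to the elements Ad(W⁻¹)(βⱼ), yields w; the new
  -- unitary is W w⁻¹, so that βⱼ ≈ Ad(W w⁻¹)(σ a).
  have step : ∀ (n : ℕ) (p : unitary B × Finset A), ∃ q : unitary B × Finset A,
      p.2 ⊆ q.2 ∧ α n ∈ q.2 ∧ (∀ a ∈ p.2, ‖c q.1 (σ a) - c p.1 (σ a)‖ < (1 / 2) ^ n) ∧
      ∀ j ≤ n, ∃ a ∈ q.2, ‖β j - c q.1 (σ a)‖ < (1 / 2) ^ n := by
    rintro n ⟨W, F⟩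
    obtain ⟨w, hw1, hw2⟩ := h F ((Finset.range (n + 1)).image fun j => c W⁻¹ (β j))
      ((1 / 2) ^ n) (by positivity)
    choose! g hg using hw2
    have hmul : ∀ x, c (W * w⁻¹) x = c W (c w⁻¹ x) := fun x => by
      simp only [c, map_mul]; rfl
    have hinv : ∀ v x, c v (c v⁻¹ x) = x := fun v x => by
      have : c v * c v⁻¹ = 1 := by simp only [c, ← map_mul, mul_inv_cancel, map_one]
      exact congrArg (fun e : B ≃⋆ₐ[ℂ] B => e x) this
    have hmove : ∀ x y, ‖c W x - c (W * w⁻¹) y‖ = ‖c w x - y‖ := fun x y => by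
      rw [hmul, ← map_sub, hc, ← hc w, map_sub, hinv]
    -- The approximate preimages of the βⱼ join the finite set, so that later stages cannot spoil
    -- these approximations.
    refine ⟨(W * w⁻¹, insert (α n) (F ∪ (Finset.range (n + 1)).image fun j => g (c W⁻¹ (β j)))),
      fun a ha => by simp [ha], by simp, fun a ha => ?_, fun j hj => ?_⟩
    · rw [norm_sub_rev, hmove]
      exact hw1 a ha
    · refine ⟨g (c W⁻¹ (β j)), ?_, ?_⟩
      · exact Finset.mem_insert_of_mem (Finset.mem_union_right _
          (Finset.mem_image_of_mem _ (Finset.mem_range_succ_iff.mpr hj)))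
      · have := hmove (c W⁻¹ (β j)) (σ (g (c W⁻¹ (β j))))
        rw [hinv] at this
        rw [this]
        exact hg _ (Finset.mem_image_of_mem _ (Finset.mem_range_succ_iff.mpr hj))
  choose next hsub hα hclose hβ using step
  let s : ℕ → unitary B × Finset A := fun n => Nat.rec (1, ∅) next n
  have hs : ∀ n, s (n + 1) = next n (s n) := fun n => rfl
  have hmono : Monotone fun n => (s n).2 := monotone_nat_of_le_succ fun n => hsub n (s n)
  let f : ℕ → A →⋆ₐ[ℂ] B := fun n => (c (s n).1 : B →⋆ₐ[ℂ] B).comp σ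
  have hf : ∀ n a, f n a = c (s n).1 (σ a) := fun _ _ => rfl
  have hnorm : ∀ n a, ‖f n a‖ = ‖a‖ := fun n a => by rw [hf, hc, hσ]
  have hgeom : ∀ m, ∀ a ∈ (s m).2, ∀ k,
      dist (f (m + k) a) (f (m + (k + 1)) a) ≤ (1 / 2) ^ m * (1 / 2) ^ k := fun m a ha k => by
    rw [dist_comm, dist_eq_norm, ← pow_add]
    exact (hclose (m + k) (s (m + k)) a (hmono (Nat.le_add_right m k) ha)).le
  have hcauchy : ∀ a, CauchySeq fun n => f n a :=
    cauchySeq_of_dense (fun n a b => by rw [← map_sub, hnorm])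
      (TopologicalSpace.denseRange_denseSeq A) (by
        rintro _ ⟨n, rfl⟩
        have := cauchySeq_of_le_geometric (1 / 2) _ (by norm_num)
          (hgeom (n + 1) (α n) (hα n (s n)))
        refine (cauchySeq_shift (n + 1)).mp ?_
        simpa only [add_comm] using! this)
  choose g hg using fun a => cauchySeq_tendsto_of_complete (hcauchy a)
  let θ := StarAlgHom.ofTendsto f g hg
  have hθ : ∀ a, ‖θ a‖ = ‖a‖ := fun a =>
    tendsto_nhds_unique ((hg a).norm) (by simp only [hnorm]; exact tendsto_const_nhds)
  have hiso : Isometry θ := AddMonoidHomClass.isometry_of_norm θ hθ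
  have hdense : DenseRange θ := by
    refine Metric.denseRange_iff.mpr fun y ε hε => ?_
    obtain ⟨j, hj⟩ := Metric.denseRange_iff.mp (TopologicalSpace.denseRange_denseSeq B) y (ε / 2)
      (by positivity)
    -- At stage n the point βⱼ is within 2⁻ⁿ of the image of some a, and all later stages together
    -- move that image by at most ∑ₖ 2⁻⁽ⁿ⁺¹⁺ᵏ⁾ = 2⁻ⁿ. Bounding each by ε/4 leaves ε/2 for
    -- approximating y by βⱼ; n ≥ j ensures that βⱼ is treated at stage n.
    obtain ⟨k, hk⟩ := exists_pow_lt_of_lt_one (show 0 < ε / 4 by positivity)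
      (show (1 / 2 : ℝ) < 1 by norm_num)
    let n := max j k
    have hn : (1 / 2 : ℝ) ^ n < ε / 4 :=
      (pow_le_pow_of_le_one (by norm_num) (by norm_num) (le_max_right j k)).trans_lt hk
    obtain ⟨a, ha, hja⟩ := hβ n (s n) j (le_max_left j k)
    have hlim : dist (f (n + 1) a) (θ a) ≤ (1 / 2) ^ (n + 1) / (1 - 1 / 2) :=
      dist_le_of_le_geometric_of_tendsto₀ (f := fun k => f (n + 1 + k) a) (1 / 2) _ (by norm_num)
        (hgeom (n + 1) a ha)
        ((hg a).comp (tendsto_add_atTop_nat (n + 1) |>.congr fun k => add_comm k (n + 1)))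
    have hja' : dist (β j) (f (n + 1) a) < (1 / 2) ^ n := by rw [dist_eq_norm]; exact hja
    refine ⟨a, ?_⟩
    have h2 : (1 / 2 : ℝ) ^ (n + 1) / (1 - 1 / 2) = (1 / 2) ^ n := by ring
    rw [h2] at hlim
    linarith [dist_triangle4 y (β j) (f (n + 1) a) (θ a)]
  have hsurj : Function.Surjective θ := by
    have := hiso.isClosedEmbedding.isClosed_range.closure_eq
    rw [hdense.closure_range] at this
    exact Set.range_eq_univ.mp this.symm
  exact ⟨StarAlgEquiv.ofBijective θ ⟨hiso.injective, hsurj⟩⟩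

end Intertwining

/-! ### Strongly self-absorbing algebras -/

/-- The Lipschitz constant is uniform in the index. This permits asymptotic identities to be checked
on elementary tensors only. -/
theorem isClosed_setOf_tendsto_zero {ι X E : Type*} [SeminormedAddCommGroup X]
    [SeminormedAddCommGroup E] {l : Filter ι} {f : ι → X → E} {C : ℝ}
    (hf : ∀ i x y, ‖f i x - f i y‖ ≤ C * ‖x - y‖) :
    IsClosed {x | Tendsto (fun i => f i x) l (𝓝 0)} := by
  refine isClosed_of_closure_subset fun x hx => ?_
  refine Metric.tendsto_nhds.mpr fun ε hε => ?_
  -- The denominator |C| + 1 is positive whatever the sign of C.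
  obtain ⟨y, hy, hxy⟩ := Metric.mem_closure_iff.mp hx (ε / 2 / (|C| + 1)) (by positivity)
  filter_upwards [Metric.tendsto_nhds.mp hy (ε / 2) (by positivity)] with i hi
  have h1 : ‖f i x - f i y‖ < ε / 2 := by
    refine (hf i x y).trans_lt ?_
    rw [dist_eq_norm, lt_div_iff₀ (by positivity)] at hxy
    nlinarith [le_abs_self C, norm_nonneg (x - y)]
  rw [dist_zero_right] at hi ⊢
  calc ‖f i x‖ = ‖(f i x - f i y) + f i y‖ := by rw [sub_add_cancel]
    _ ≤ ‖f i x - f i y‖ + ‖f i y‖ := norm_add_le _ _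
    _ < ε := by linarith

section Central

variable {D A : Type u} [CStarAlgebra D] [CStarAlgebra A]

/-- Dilation places each representation space of A inside a representation space of D, and 1 ⊗ V
intertwines the two copies of π(a) ⊗ 1. The compression identity itself plays no role. -/
theorem IsDilatable.norm_inl_le {ψ : D →ₗ[ℂ] A} (hψ : IsDilatable ψ) (a : A) :
    ‖MinTensor.inl A A a‖ ≤ ‖MinTensor.inl A D a‖ := by
  rw [MinTensor.inl_apply, MinTensor.inl_apply, MinTensor.tmul, MinTensor.tmul,
    MinTensor.norm_ofAlg, MinTensor.norm_ofAlg]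
  refine AlgTensor.norm_le (AlgTensor.norm_nonneg' _) fun p => ?_
  obtain ⟨K, _, _, _, σ, V, -⟩ := hψ p.K p.ρ
  let q : RepPair A D := { H := p.H, K := K, π := p.π, ρ := σ }
  refine le_trans ?_ (AlgTensor.norm_rep_le q _)
  rw [RepPair.rep_tmul, RepPair.rep_tmul]
  refine ContinuousLinearMap.opNorm_le_bound _ (norm_nonneg _) fun ζ => ?_
  induction ζ using HilbertTensor.induction_on with
  | hp => apply isClosed_le <;> fun_prop
  | ih z =>
    let W : p.H ⊗[ℂ] p.K →ₗᵢ[ℂ] p.H ⊗[ℂ] K := V.lTensor p.H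
    have hW : TensorProduct.mapL (q.π a) (q.ρ 1) (W z) =
        W (TensorProduct.mapL (p.π a) (p.ρ 1) z) := by
      rw [map_one, map_one]
      induction z using TensorProduct.induction_on with
      | zero => simp
      | add z z' hz hz' => simp only [map_add, hz, hz']
      | tmul b c => rfl
    rw [opTensor_of, LinearIsometry.norm_map, ← W.norm_map, ← hW, LinearIsometry.norm_map,
      ← W.norm_map z, ← (HilbertTensor.of (H := p.H) (K := K)).norm_map,
      ← (HilbertTensor.of (H := p.H) (K := K)).norm_map (W z), ← opTensor_of]
    exact ContinuousLinearMap.le_opNorm _ _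

/-- The embedding is a pointwise limit of the isometric maps Ad(wₙ) ∘ φ. -/
theorem IsStronglySelfAbsorbing.norm_inl (hA : IsStronglySelfAbsorbing A) (a : A) :
    ‖MinTensor.inl A A a‖ = ‖a‖ := by
  obtain ⟨φ, w, hw⟩ := hA.exists_equiv
  have h1 := (tendsto_iff_norm_sub_tendsto_zero.mpr (hw a)).norm
  refine tendsto_nhds_unique h1 ?_
  simp only [norm_conj_unitary]
  exact tendsto_const_nhds.congr fun _ => (StarAlgEquiv.norm_map φ a).symm

/-- Unitaries of `D ⊗ D` move finite subsets of `1 ⊗ D` close to `D ⊗ 1`. -/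
theorem IsStronglySelfAbsorbing.exists_unitary_conj_inr (hD : IsStronglySelfAbsorbing D)
    (G : Finset D) {ε : ℝ} (hε : 0 < ε) :
    ∃ w : unitary (MinTensor D D), ∀ d ∈ G, ∃ y,
      ‖(w : MinTensor D D) * MinTensor.inr D D d * star (w : MinTensor D D) -
        MinTensor.inl D D y‖ < ε := by
  obtain ⟨φ, w, hw⟩ := hD.exists_equiv
  -- Surjectivity of φ supplies y = φ⁻¹(1 ⊗ d), and wₙ φ(y) wₙ⋆ → y ⊗ 1.
  have h : ∀ᶠ n in atTop, ∀ d ∈ G,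
      ‖(w n : MinTensor D D) * MinTensor.inr D D d * star (w n : MinTensor D D) -
        MinTensor.inl D D (φ.symm (MinTensor.inr D D d))‖ < ε := by
    refine (eventually_all_finset G).mpr fun d _ => ?_
    filter_upwards [(hw (φ.symm (MinTensor.inr D D d))).eventually_lt_const hε] with n hn
    have : φ (φ.symm (MinTensor.inr D D d)) = MinTensor.inr D D d := φ.apply_symm_apply _
    rw [← this]
    simpa using hn
  obtain ⟨n, hn⟩ := h.exists
  exact ⟨w n, fun d hd => ⟨_, hn d hd⟩⟩

/-- A strongly self-absorbing algebra has endomorphisms that almost commute with any given finite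
sets. -/
theorem IsStronglySelfAbsorbing.exists_central_endomorphism (hA : IsStronglySelfAbsorbing A)
    (F G : Finset A) {ε : ℝ} (hε : 0 < ε) :
    ∃ g : A →⋆ₐ[ℂ] A, ∀ x ∈ F, ∀ a ∈ G, ‖g x * a - a * g x‖ < ε := by
  obtain ⟨α, w, hw⟩ := hA.exists_equiv
  -- Since 1 ⊗ x commutes with a ⊗ 1, it almost commutes with e(a), where e = Ad(wₙ) ∘ α; pulling
  -- back along e gives g(x) = e⁻¹(1 ⊗ x).
  have h : ∀ᶠ n in atTop, ∀ x ∈ F, ∀ a ∈ G,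
      ‖MinTensor.inr A A x * (w n * α a * star (w n : MinTensor A A)) -
        (w n * α a * star (w n : MinTensor A A)) * MinTensor.inr A A x‖ < ε := by
    refine (eventually_all_finset F).mpr fun x _ => (eventually_all_finset G).mpr fun a _ => ?_
    have h1 := tendsto_iff_norm_sub_tendsto_zero.mpr (hw a)
    have h2 := ((h1.const_mul (MinTensor.inr A A x)).sub (h1.mul_const (MinTensor.inr A A x))).norm
    refine h2.eventually_lt_const ?_
    change ‖MinTensor.inr A A x * MinTensor.inl A A a -
      MinTensor.inl A A a * MinTensor.inr A A x‖ < ε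
    rwa [MinTensor.inl_mul_inr, MinTensor.inr_mul_inl, sub_self, norm_zero]
  obtain ⟨n, hn⟩ := h.exists
  let c := Unitary.conjStarAlgAut ℂ (MinTensor A A) (w n)
  let e : A ≃⋆ₐ[ℂ] MinTensor A A := α.trans c
  refine ⟨(e.symm : MinTensor A A →⋆ₐ[ℂ] A).comp (MinTensor.inr A A), fun x hx a ha => ?_⟩
  rw [← StarAlgEquiv.norm_map e, map_sub, map_mul, map_mul]
  have h3 : e (((e.symm : MinTensor A A →⋆ₐ[ℂ] A).comp (MinTensor.inr A A)) x) =
    MinTensor.inr A A x := e.apply_symm_apply _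
  rw [h3]
  exact hn x hx a ha

end Central

/-! ### Asymptotically multiplicative, asymptotically central nets -/

/-- An asymptotically multiplicative and asymptotically central net of unital dilatable maps
`D → A`. -/
structure CentralNet {D A : Type u} [CStarAlgebra D] [CStarAlgebra A] {ι : Type*} (l : Filter ι)
    (ψ : ι → D →ₗ[ℂ] A) : Prop where
  isDilatable (i : ι) : IsDilatable (ψ i)
  map_one (i : ι) : ψ i 1 = 1
  map_star (i : ι) (d : D) : ψ i (star d) = star (ψ i d)
  tendsto_mul (c d : D) : Tendsto (fun i => ψ i (c * d) - ψ i c * ψ i d) l (𝓝 0)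
  tendsto_comm (d : D) (a : A) : Tendsto (fun i => ψ i d * a - a * ψ i d) l (𝓝 0)

/-- Turns choices made for each pair of finite sets and each tolerance 1/(n+1) into limits along one
directed set. -/
theorem tendsto_atTop_finset_prod {X Y E : Type*} [SeminormedAddCommGroup E]
    {f : Finset X × Finset Y × ℕ → E} (F : Finset X) (G : Finset Y)
    (h : ∀ i : Finset X × Finset Y × ℕ, F ⊆ i.1 → G ⊆ i.2.1 → ‖f i‖ < 1 / (i.2.2 + 1)) :
    Tendsto f atTop (𝓝 0) := by
  refine Metric.tendsto_nhds.mpr fun ε hε => ?_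
  obtain ⟨n, hn⟩ := exists_nat_one_div_lt hε
  filter_upwards [eventually_ge_atTop (F, G, n)] with i hi
  rw [dist_zero_right]
  have h1 : (n : ℝ) ≤ i.2.2 := Nat.cast_le.mpr hi.2.2
  exact (h i hi.1 hi.2.1).trans
    ((one_div_le_one_div_of_le (by positivity) (by linarith)).trans_lt hn)

-- Each member is g ∘ φ, with φ almost multiplicative on F and g an endomorphism of A almost
-- commuting on φ(F) with G. Being a contractive ⋆-homomorphism, g does not increase the
-- multiplicative defect of φ.
open scoped CStarAlgebra in
theorem IsStronglySelfAbsorbing.exists_centralNet {D A : Type u}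
    [CStarAlgebra D] [PartialOrder D] [StarOrderedRing D]
    [CStarAlgebra A] [PartialOrder A] [StarOrderedRing A]
    (hA : IsStronglySelfAbsorbing A)
    (h : ∀ (F : Finset D) (ε : ℝ), 0 < ε →
      ∃ φ : D →CP A, φ 1 = 1 ∧ ∀ c ∈ F, ∀ d ∈ F, ‖φ (c * d) - φ c * φ d‖ < ε) :
    ∃ ψ : Finset D × Finset A × ℕ → D →ₗ[ℂ] A, CentralNet atTop ψ := by
  classical
  have key : ∀ i : Finset D × Finset A × ℕ, ∃ ψ : D →ₗ[ℂ] A, IsDilatable ψ ∧ ψ 1 = 1 ∧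
      (∀ d, ψ (star d) = star (ψ d)) ∧
      (∀ c ∈ i.1, ∀ d ∈ i.1, ‖ψ (c * d) - ψ c * ψ d‖ < 1 / (i.2.2 + 1)) ∧
      ∀ d ∈ i.1, ∀ a ∈ i.2.1, ‖ψ d * a - a * ψ d‖ < 1 / (i.2.2 + 1) := by
    rintro ⟨F, G, n⟩
    obtain ⟨φ, hφ1, hφ⟩ := h F (1 / (n + 1)) (by positivity)
    obtain ⟨g, hg⟩ := hA.exists_central_endomorphism (F.image φ) G
      (show 0 < 1 / ((n : ℝ) + 1) by positivity)
    refine ⟨g.toAlgHom.toLinearMap ∘ₗ (φ : D →ₗ[ℂ] A), (φ.isDilatable hφ1).comp_starAlgHom g,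
      (congrArg g hφ1).trans (map_one g), fun d => ?_, fun c hc d hd => ?_, fun d hd a ha => ?_⟩
    · change g (φ (star d)) = star (g (φ d))
      rw [map_star, map_star]
    · change ‖g (φ (c * d)) - g (φ c) * g (φ d)‖ < _
      rw [← map_mul, ← map_sub]
      exact (NonUnitalStarAlgHom.norm_apply_le g _).trans_lt (hφ c hc d hd)
    · exact hg _ (Finset.mem_image_of_mem φ hd) a ha
  choose ψ h1 h2 h3 h4 h5 using key
  refine ⟨ψ, h1, h2, h3, fun c d => ?_, fun d a => ?_⟩
  · exact tendsto_atTop_finset_prod {c, d} ∅ fun i hi _ =>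
      h4 i c (hi (by simp)) d (hi (by simp))
  · exact tendsto_atTop_finset_prod {d} {a} fun i hi hi' =>
      h5 i d (hi (by simp)) a (hi' (by simp))

namespace CentralNet

variable {D A : Type u} [CStarAlgebra D] [CStarAlgebra A] {ι : Type*} {l : Filter ι}
  {ψ : ι → D →ₗ[ℂ] A} (hψ : CentralNet l ψ) {E : Type v} [CStarAlgebra E]

variable (E) in
/-- The contractions `ψ i ⊗ id`. -/
def ext (i : ι) : MinTensor D E →L[ℂ] MinTensor A E := (hψ.isDilatable i).mapLeft E

theorem ext_tmul (i : ι) (d : D) (e : E) :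
    hψ.ext E i (MinTensor.tmul d e) = MinTensor.tmul (ψ i d) e :=
  (hψ.isDilatable i).mapLeft_tmul d e

theorem norm_ext_le (i : ι) (x : MinTensor D E) : ‖hψ.ext E i x‖ ≤ ‖x‖ :=
  (hψ.isDilatable i).norm_mapLeft_le x

theorem ext_inr (i : ι) (e : E) : hψ.ext E i (MinTensor.inr D E e) = MinTensor.inr A E e := by
  rw [MinTensor.inr_apply, hψ.ext_tmul, hψ.map_one, MinTensor.inr_apply]

theorem ext_inl (i : ι) (d : D) :
    hψ.ext E i (MinTensor.inl D E d) = MinTensor.inl A E (ψ i d) := hψ.ext_tmul i d 1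

theorem ext_one (i : ι) : hψ.ext E i 1 = 1 := by
  rw [← _root_.map_one (MinTensor.inr D E), hψ.ext_inr, _root_.map_one]

theorem ext_star (i : ι) (x : MinTensor D E) : hψ.ext E i (star x) = star (hψ.ext E i x) := by
  induction x using MinTensor.induction_tmul with
  | hp => apply isClosed_eq <;> fun_prop
  | add x y hx hy => simp only [star_add, map_add, hx, hy]
  | tmul d e =>
    rw [MinTensor.star_tmul, hψ.ext_tmul, hψ.ext_tmul, MinTensor.star_tmul, hψ.map_star]

theorem tendsto_tmul {f : ι → A} (hf : Tendsto f l (𝓝 0)) (e : E) :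
    Tendsto (fun i => MinTensor.tmul (f i) e) l (𝓝 0) := by
  refine squeeze_zero_norm (fun i => MinTensor.norm_tmul_le (f i) e) ?_
  simpa using hf.norm.mul_const ‖e‖

/-- The defect is bilinear and bounded uniformly in the index, because the maps ψᵢ ⊗ id are
contractions. On elementary tensors it is (ψᵢ(dd') - ψᵢ(d)ψᵢ(d')) ⊗ ee'. -/
theorem tendsto_ext_mul (x y : MinTensor D E) :
    Tendsto (fun i => hψ.ext E i (x * y) - hψ.ext E i x * hψ.ext E i y) l (𝓝 0) := by
  induction x using MinTensor.induction_tmul with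
  | hp =>
    refine isClosed_setOf_tendsto_zero (C := 2 * ‖y‖) fun i x x' => ?_
    have : hψ.ext E i (x * y) - hψ.ext E i x * hψ.ext E i y -
        (hψ.ext E i (x' * y) - hψ.ext E i x' * hψ.ext E i y) =
        hψ.ext E i ((x - x') * y) - hψ.ext E i (x - x') * hψ.ext E i y := by
      simp only [sub_mul, map_sub]; abel
    rw [this]
    refine (norm_sub_le _ _).trans ?_
    have h1 := (hψ.norm_ext_le i ((x - x') * y)).trans (norm_mul_le _ _)
    have h2 := (norm_mul_le (hψ.ext E i (x - x')) (hψ.ext E i y)).trans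
      (mul_le_mul (hψ.norm_ext_le i _) (hψ.norm_ext_le i _) (norm_nonneg _) (norm_nonneg _))
    linarith
  | add x x' hx hx' =>
    refine (add_zero (0 : MinTensor A E) ▸ hx.add hx').congr fun i => ?_
    simp only [add_mul, map_add]; abel
  | tmul d e =>
    induction y using MinTensor.induction_tmul with
    | hp =>
      refine isClosed_setOf_tendsto_zero (C := 2 * ‖(MinTensor.tmul d e : MinTensor D E)‖)
        fun i y y' => ?_
      set x : MinTensor D E := MinTensor.tmul d e
      have : hψ.ext E i (x * y) - hψ.ext E i x * hψ.ext E i y -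
          (hψ.ext E i (x * y') - hψ.ext E i x * hψ.ext E i y') =
          hψ.ext E i (x * (y - y')) - hψ.ext E i x * hψ.ext E i (y - y') := by
        simp only [mul_sub, map_sub]; abel
      rw [this]
      refine (norm_sub_le _ _).trans ?_
      have h1 := (hψ.norm_ext_le i (x * (y - y'))).trans (norm_mul_le _ _)
      have h2 := (norm_mul_le (hψ.ext E i x) (hψ.ext E i (y - y'))).trans
        (mul_le_mul (hψ.norm_ext_le i _) (hψ.norm_ext_le i _) (norm_nonneg _) (norm_nonneg _))
      linarith
    | add y y' hy hy' =>
      refine (add_zero (0 : MinTensor A E) ▸ hy.add hy').congr fun i => ?_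
      simp only [mul_add, map_add]; abel
    | tmul d' e' =>
      refine (tendsto_tmul (hψ.tendsto_mul d d') (e * e')).congr fun i => ?_
      rw [MinTensor.tmul_mul_tmul, hψ.ext_tmul, hψ.ext_tmul, hψ.ext_tmul,
        MinTensor.tmul_mul_tmul, MinTensor.sub_tmul]

/-- On elementary tensors the commutator is (ψᵢ(d)a - aψᵢ(d)) ⊗ e; uniform boundedness extends the
limit to all x. -/
theorem tendsto_ext_comm (x : MinTensor D E) (a : A) :
    Tendsto (fun i => hψ.ext E i x * MinTensor.inl A E a - MinTensor.inl A E a * hψ.ext E i x) l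
      (𝓝 0) := by
  set b := MinTensor.inl A E a with hb
  induction x using MinTensor.induction_tmul with
  | hp =>
    refine isClosed_setOf_tendsto_zero (C := 2 * ‖b‖) fun i x x' => ?_
    have : hψ.ext E i x * b - b * hψ.ext E i x - (hψ.ext E i x' * b - b * hψ.ext E i x') =
        hψ.ext E i (x - x') * b - b * hψ.ext E i (x - x') := by
      simp only [mul_sub, sub_mul, map_sub]; abel
    rw [this]
    refine (norm_sub_le _ _).trans ?_
    have h1 := (norm_mul_le (hψ.ext E i (x - x')) b).trans
      (mul_le_mul_of_nonneg_right (hψ.norm_ext_le i _) (norm_nonneg _))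
    have h2 := (norm_mul_le b (hψ.ext E i (x - x'))).trans
      (mul_le_mul_of_nonneg_left (hψ.norm_ext_le i _) (norm_nonneg _))
    linarith
  | add x x' hx hx' =>
    refine (add_zero (0 : MinTensor A E) ▸ hx.add hx').congr fun i => ?_
    simp only [mul_add, add_mul, map_add]; abel
  | tmul d e =>
    refine (tendsto_tmul (hψ.tendsto_comm d a) e).congr fun i => ?_
    rw [hψ.ext_tmul, hb, MinTensor.inl_apply, MinTensor.tmul_mul_tmul, MinTensor.tmul_mul_tmul,
      one_mul, mul_one, MinTensor.sub_tmul]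

theorem isBoundedUnder_norm_ext (x : MinTensor D E) :
    IsBoundedUnder (· ≤ ·) l (norm ∘ fun i => hψ.ext E i x) :=
  isBoundedUnder_of ⟨‖x‖, fun i => hψ.norm_ext_le i x⟩

/-- The images of a unitary of `D ⊗ E` under the maps `ψ i ⊗ id` are asymptotically unitary. -/
theorem exists_unitary (w : unitary (MinTensor D E)) :
    ∃ U : ι → unitary (MinTensor A E),
      Tendsto (fun i => (U i : MinTensor A E) - hψ.ext E i w) l (𝓝 0) := by
  have h1 : Tendsto (fun i => 1 - star (hψ.ext E i w) * hψ.ext E i w) l (𝓝 0) :=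
    (hψ.tendsto_ext_mul (star (w : MinTensor D E)) w).congr fun i => by
      rw [Unitary.coe_star_mul_self, hψ.ext_one, hψ.ext_star]
  have h2 : Tendsto (fun i => 1 - hψ.ext E i w * star (hψ.ext E i w)) l (𝓝 0) :=
    (hψ.tendsto_ext_mul w (star (w : MinTensor D E))).congr fun i => by
      rw [Unitary.mul_star_self_of_mem w.2, hψ.ext_one, hψ.ext_star]
  have key : ∀ i, ∃ U : unitary (MinTensor A E),
      ‖1 - star (hψ.ext E i w) * hψ.ext E i w‖ < 1 →
      ‖1 - hψ.ext E i w * star (hψ.ext E i w)‖ < 1 →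
      ‖(U : MinTensor A E) - hψ.ext E i w‖ ≤ ‖1 - star (hψ.ext E i w) * hψ.ext E i w‖ := by
    intro i
    by_cases h : ‖1 - star (hψ.ext E i w) * hψ.ext E i w‖ < 1 ∧
        ‖1 - hψ.ext E i w * star (hψ.ext E i w)‖ < 1
    · obtain ⟨U, hU⟩ := exists_unitary_norm_sub_le h.1 h.2
      exact ⟨U, fun _ _ => hU⟩
    · exact ⟨1, fun ha hb => absurd ⟨ha, hb⟩ h⟩
  choose U hU using key
  refine ⟨U, squeeze_zero_norm' ?_ (by simpa using h1.norm)⟩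
  have n1 := h1.norm
  have n2 := h2.norm
  rw [norm_zero] at n1 n2
  filter_upwards [n1.eventually_lt_const one_pos, n2.eventually_lt_const one_pos] with i hi hi'
  exact hU i hi hi'

theorem norm_unitary_conj_sub {B : Type*} [CStarAlgebra B] (U : unitary B) (x : B) :
    ‖(U : B) * x * star (U : B) - x‖ = ‖(U : B) * x - x * U‖ := by
  rw [← CStarRing.norm_mul_coe_unitary _ U, sub_mul, mul_assoc _ (star (U : B)),
    Unitary.coe_star_mul_self, mul_one]

/-- A unitary w of D ⊗ D moving 1 ⊗ G close to D ⊗ 1 is transported by ψᵢ ⊗ id, which fixes the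
second factor and sends D ⊗ 1 into A ⊗ 1. Half of ε pays for the choice of w, half for the
transport. -/
theorem exists_unitary_conj_inr {ψ : ι → D →ₗ[ℂ] A} (hψ : CentralNet l ψ) [l.NeBot]
    (hD : IsStronglySelfAbsorbing D)
    (F : Finset A) (G : Finset D) {ε : ℝ} (hε : 0 < ε) :
    ∃ U : unitary (MinTensor A D),
      (∀ a ∈ F, ‖(U : MinTensor A D) * MinTensor.inl A D a * star (U : MinTensor A D) -
        MinTensor.inl A D a‖ < ε) ∧
      ∀ d ∈ G, ∃ y, ‖(U : MinTensor A D) * MinTensor.inr A D d * star (U : MinTensor A D) -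
        MinTensor.inl A D y‖ < ε := by
  obtain ⟨w, hw⟩ := hD.exists_unitary_conj_inr G (half_pos hε)
  obtain ⟨U, hU⟩ := hψ.exists_unitary w
  have hUb : IsBoundedUnder (· ≤ ·) l (norm ∘ fun i => star (U i : MinTensor A D)) :=
    isBoundedUnder_of ⟨‖(1 : MinTensor A D)‖, fun i => by
      have := CStarRing.norm_coe_unitary_mul (U i) (1 : MinTensor A D)
      simp only [Function.comp_apply, norm_star]
      rw [← this, mul_one]⟩
  have h1 : ∀ᶠ i in l, ∀ a ∈ F,
      ‖(U i : MinTensor A D) * MinTensor.inl A D a * star (U i : MinTensor A D) -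
        MinTensor.inl A D a‖ < ε := by
    refine (eventually_all_finset F).mpr fun a _ => ?_
    have h : Tendsto (fun i => (U i : MinTensor A D) * MinTensor.inl A D a -
        MinTensor.inl A D a * U i) l (𝓝 0) := by
      have := ((hU.mul_const (MinTensor.inl A D a)).sub
        (hU.const_mul (MinTensor.inl A D a))).add (hψ.tendsto_ext_comm (w : MinTensor D D) a)
      simp only [zero_mul, mul_zero, sub_zero, add_zero] at this
      refine this.congr fun i => ?_
      simp only [sub_mul, mul_sub]; abel
    have h' := h.norm
    rw [norm_zero] at h'
    filter_upwards [h'.eventually_lt_const hε] with i hi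
    rwa [norm_unitary_conj_sub]
  have h2 : ∀ᶠ i in l, ∀ d ∈ G, ∃ y,
      ‖(U i : MinTensor A D) * MinTensor.inr A D d * star (U i : MinTensor A D) -
        MinTensor.inl A D y‖ < ε := by
    refine (eventually_all_finset G).mpr fun d hd => ?_
    obtain ⟨y, hy⟩ := hw d hd
    set x := MinTensor.inr D D d with hx
    have h : Tendsto (fun i => (U i : MinTensor A D) * MinTensor.inr A D d *
        star (U i : MinTensor A D) - hψ.ext D i (w * x * star (w : MinTensor D D))) l (𝓝 0) := by
      -- With b = 1 ⊗ d and W = (ψᵢ ⊗ id)(w), the difference telescopes: `t1` and `t2` replace U b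
      -- U⋆ by W b W⋆, and `t3` and `t4` absorb W b W⋆ into the image of w x w⋆.
      have hL : Tendsto (fun i => ((U i : MinTensor A D) - hψ.ext D i w) *
          MinTensor.inr A D d) l (𝓝 0) := by
        simpa only [zero_mul] using hU.mul_const (MinTensor.inr A D d)
      have t1 := hL.zero_mul_isBoundedUnder_le (g := fun i => star (U i : MinTensor A D)) hUb
      have hR : Tendsto (fun i => MinTensor.inr A D d *
          star ((U i : MinTensor A D) - hψ.ext D i w)) l (𝓝 0) := by
        simpa only [star_zero, mul_zero] using hU.star.const_mul (MinTensor.inr A D d)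
      have t2 := isBoundedUnder_le_mul_tendsto_zero
        (hψ.isBoundedUnder_norm_ext (w : MinTensor D D)) hR
      have t3 := (hψ.tendsto_ext_mul (w : MinTensor D D) x).zero_mul_isBoundedUnder_le
        (hψ.isBoundedUnder_norm_ext (star (w : MinTensor D D)))
      have t4 := hψ.tendsto_ext_mul ((w : MinTensor D D) * x) (star (w : MinTensor D D))
      have := ((t1.add t2).sub t3).sub t4
      simp only [sub_zero, add_zero] at this
      refine this.congr fun i => ?_
      rw [hx, hψ.ext_inr, hψ.ext_star]
      simp only [sub_mul, mul_sub, star_sub, mul_assoc]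
      abel
    have h' := h.norm
    rw [norm_zero] at h'
    filter_upwards [h'.eventually_lt_const (half_pos hε)] with i hi
    -- The image of y ⊗ 1 under ψᵢ ⊗ id is ψᵢ(y) ⊗ 1.
    refine ⟨ψ i y, ?_⟩
    have h3 := (hψ.norm_ext_le i _).trans_lt hy
    rw [map_sub, hψ.ext_inl] at h3
    calc _ = ‖((U i : MinTensor A D) * MinTensor.inr A D d * star (U i : MinTensor A D) -
          hψ.ext D i (w * x * star (w : MinTensor D D))) +
          (hψ.ext D i (w * x * star (w : MinTensor D D)) - MinTensor.inl A D (ψ i y))‖ := by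
            rw [sub_add_sub_cancel]
      _ ≤ _ := norm_add_le _ _
      _ < ε := by linarith
  obtain ⟨i, hi, hi'⟩ := (h1.and h2).exists
  exact ⟨U i, hi, hi'⟩

end CentralNet

/-! ### From the second factor to A ⊗ D, and conclusion -/

/-- If unitaries almost commuting with `A ⊗ 1` move finite subsets of `1 ⊗ D` close to `A ⊗ 1`,
then they also move finite subsets of `A ⊗ D` close to `A ⊗ 1`. -/
theorem MinTensor.exists_unitary_conj {A : Type u} {D : Type v} [CStarAlgebra A] [CStarAlgebra D]
    (h : ∀ (F : Finset A) (G : Finset D) (ε : ℝ), 0 < ε → ∃ U : unitary (MinTensor A D),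
      (∀ a ∈ F, ‖(U : MinTensor A D) * inl A D a * star (U : MinTensor A D) - inl A D a‖ < ε) ∧
      ∀ d ∈ G, ∃ y,
        ‖(U : MinTensor A D) * inr A D d * star (U : MinTensor A D) - inl A D y‖ < ε)
    (F : Finset A) (G : Finset (MinTensor A D)) {ε : ℝ} (hε : 0 < ε) :
    ∃ U : unitary (MinTensor A D),
      (∀ a ∈ F, ‖(U : MinTensor A D) * inl A D a * star (U : MinTensor A D) - inl A D a‖ < ε) ∧
      ∀ b ∈ G, ∃ y, ‖(U : MinTensor A D) * b * star (U : MinTensor A D) - inl A D y‖ < ε := by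
  classical
  choose U hU hU' using fun i : Finset A × Finset D × ℕ =>
    h i.1 i.2.1 (1 / (i.2.2 + 1)) (by positivity)
  let c : ∀ i, MinTensor A D ≃⋆ₐ[ℂ] MinTensor A D := fun i => Unitary.conjStarAlgAut ℂ _ (U i)
  have hc : ∀ i x, ‖c i x‖ = ‖x‖ := fun i x => StarAlgEquiv.norm_map (c i) x
  have hinl : ∀ a, Tendsto (fun i => c i (inl A D a) - inl A D a) atTop (𝓝 0) := fun a =>
    tendsto_atTop_finset_prod {a} ∅ fun i hi _ => hU i a (hi (by simp))
  have hinr : ∀ d, ∃ y : Finset A × Finset D × ℕ → A,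
      Tendsto (fun i => c i (inr A D d) - inl A D (y i)) atTop (𝓝 0) := fun d => by
    choose! y hy using hU'
    exact ⟨fun i => y i d, tendsto_atTop_finset_prod ∅ {d} fun i _ hi => hy i d (hi (by simp))⟩
  -- Quantifying over all δ makes the property closed and additive in x, since δ can be halved.
  have key : ∀ x : MinTensor A D, ∀ δ > 0, ∀ᶠ i in atTop, ∃ y, ‖c i x - inl A D y‖ < δ := by
    intro x
    induction x using induction_tmul with
    | hp =>
      refine isClosed_of_closure_subset fun x hx δ hδ => ?_
      obtain ⟨x', hx', hd⟩ := Metric.mem_closure_iff.mp hx (δ / 2) (half_pos hδ)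
      filter_upwards [hx' (δ / 2) (half_pos hδ)] with i ⟨y, hy⟩
      refine ⟨y, ?_⟩
      have h1 : ‖c i x - c i x'‖ < δ / 2 := by rw [← map_sub, hc, ← dist_eq_norm]; exact hd
      linarith [norm_sub_le_norm_sub_add_norm_sub (c i x) (c i x') (inl A D y)]
    | add x x' hx hx' =>
      intro δ hδ
      filter_upwards [hx (δ / 2) (half_pos hδ), hx' (δ / 2) (half_pos hδ)] with i ⟨y, hy⟩ ⟨y', hy'⟩
      refine ⟨y + y', ?_⟩
      rw [map_add, map_add, add_sub_add_comm]
      linarith [norm_add_le (c i x - inl A D y) (c i x' - inl A D y')]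
    | tmul a d =>
      intro δ hδ
      obtain ⟨y, hy⟩ := hinr d
      have t1 := (hinl a).zero_mul_isBoundedUnder_le (g := fun i => c i (inr A D d))
        (isBoundedUnder_of ⟨‖inr A D d‖, fun i => (hc i _).le⟩)
      have t2 := (hy.const_mul (inl A D a)).add t1
      rw [mul_zero, add_zero] at t2
      have t3 := t2.norm
      rw [norm_zero] at t3
      filter_upwards [t3.eventually_lt_const hδ] with i hi
      -- The conjugate of a ⊗ d = (a ⊗ 1)(1 ⊗ d) is close to (a ⊗ 1)(yᵢ ⊗ 1).
      refine ⟨a * y i, ?_⟩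
      rw [← inl_mul_inr, map_mul, map_mul]
      convert! hi using 2
      simp only [mul_sub, sub_mul]; abel
  have hF : ∀ᶠ i in atTop, ∀ a ∈ F, ‖c i (inl A D a) - inl A D a‖ < ε :=
    (eventually_all_finset F).mpr fun a _ => by
      have := (hinl a).norm
      rw [norm_zero] at this
      exact this.eventually_lt_const hε
  have hG : ∀ᶠ i in atTop, ∀ b ∈ G, ∃ y, ‖c i b - inl A D y‖ < ε :=
    (eventually_all_finset G).mpr fun b _ => key b ε hε
  obtain ⟨i, hi, hi'⟩ := (hF.and hG).exists
  exact ⟨U i, hi, hi'⟩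

end
open scoped CStarAlgebra in
theorem proposition2p8 {D A : Type u}
    [CStarAlgebra D] [PartialOrder D] [StarOrderedRing D]
    [CStarAlgebra A] [PartialOrder A] [StarOrderedRing A]
    (hD : IsStronglySelfAbsorbing D) (hA : IsStronglySelfAbsorbing A)
    (h : ∀ (F : Finset D) (ε : ℝ), 0 < ε →
      ∃ φ : D →CP A, φ 1 = 1 ∧ ∀ c ∈ F, ∀ d ∈ F, ‖φ (c * d) - φ c * φ d‖ < ε) :
    Nonempty (A ≃⋆ₐ[ℂ] MinTensor A D) := by
  classical
  obtain ⟨ψ, hψ⟩ := hA.exists_centralNet h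
  have := hD.separable
  have := hA.separable
  have : TopologicalSpace.SeparableSpace (MinTensor A D) := MinTensor.separableSpace
  refine nonempty_starAlgEquiv_of_intertwining (MinTensor.inl A D) (fun a => ?_)
    fun F G ε hε => MinTensor.exists_unitary_conj
      (fun F G ε hε => hψ.exists_unitary_conj_inr hD F G hε) F G hε
  -- The lower bound passes through A ⊗ A, where a ↦ a ⊗ 1 is isometric; any single member of the
  -- net serves for the comparison with A ⊗ D.
  refine le_antisymm (NonUnitalStarAlgHom.norm_apply_le _ a) ?_
  rw [← hA.norm_inl a]
  exact (hψ.isDilatable (∅, ∅, 0)).norm_inl_le a
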